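/- Let $K$ be an algebraically closed field of characteristic $2$, let $d\in K$, and let $$R=R(2,0,d)=K\langle x,y\rangle\big/\big(x^2+yxy,\ y^2+xyx+d(xy)^2,\ x(yx)^2,\ y(xy)^2\big).$$ Write $\Lambda=R\otimes_K R^{op}$, and regard $\Lambda$-modules as $R$-bimodules. Let $P_\bullet$ be the $4$-periodic complex of free bimodules $P_0=P_3=\Lambda$, $P_1=P_2=\Lambda^2$, $P_{n+4}=P_n$, with generators $1\otimes1$ of $P_0$ and of $P_3$, $\epsilon_x,\epsilon_y$ of $P_1$, $\epsilon_{r_x},\epsilon_{r_y}$ of $P_2$, with augmentation $\mu:P_0\to R$, $\mu(a\otimes b)=ab$, and with differentials $d_n:P_{n+1}\to P_n$, $d_{n+4}=d_n$, given by \begin{align*} d_0(\epsilon_x)&=x\otimes 1+1\otimes x,\qquad d_0(\epsilon_y)=y\otimes 1+1\otimes y,\\ d_1(\epsilon_{r_x})&=\epsilon_x x+x\epsilon_x+y\epsilon_x y+\epsilon_y xy+yx\,\epsilon_y,\\ d_1(\epsilon_{r_y})&=\epsilon_y y+y\epsilon_y+x\epsilon_y x+d\,x\epsilon_y xy+d\,xyx\,\epsilon_y+\epsilon_x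 yx+xy\,\epsilon_x+d\,xy\,\epsilon_x y+d\,\epsilon_x yxy,\\ d_2(1\otimes 1)&=x\epsilon_{r_x}+\epsilon_{r_x}x+y\epsilon_{r_y}+\epsilon_{r_y}y+d\,y\epsilon_{r_y}y+d\,\epsilon_{r_y}xyx+d^2\,y\epsilon_{r_y}xyx,\\ d_3(1\otimes 1)&=1\otimes (xy)^2+xy\otimes xy+(xy)^2\otimes 1+yx\otimes yx+y\otimes xyx+yxy\otimes x+x\otimes yxy+xyx\otimes y+d\,xyx\otimes xyx. \end{align*} Let $w_1,w_2,w_3\in\mathrm{Hom}_\Lambda(P_2,R)$ and $e\in\mathrm{Hom}_\Lambda(P_4,R)$ be the cocycles whose values on the generators $(\epsilon_{r_x},\epsilon_{r_y})$, respectively on $1\otimes 1$, are $$w_1=(x,0),\quad w_2=(0,y),\quad w_3=(y,\ x+dxy),\quad e=1 .$$ A comparison morphism is a morphism of complexes of bimodules $\Psi$ from the bar resolution of $R$ to $P_\bullet$ that lifts the identity of $R$; it sends a cocycle $c\in\mathrm{Hom}_\Lambda(P_n,R)$ to the class of the Hochschild cocycle $c\circ\Psi_n$ in $HH^n(R)$.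 Then comparison morphisms exist, and for every comparison morphism $\Psi$ the classes of $w_1,w_2,w_3$ in $HH^2(R)$ and of $e$ in $HH^4(R)$ satisfy $$[w_1,e]=[w_2,e]=[w_3,e]=0\quad\text{in } HH^5(R),$$ where $[-,-]$ is the Gerstenhaber bracket: for all Hochschild cocycles $f$ representing $w_i$ and $g$ representing $e$, the bracket $[f,g]=f\circ g-(-1)^{(|f|-1)(|g|-1)}g\circ f$, where $f\circ g=\sum_i(-1)^{(|g|-1)(i-1)}f\circ_i g$ and $f\circ_i g$ inserts $g$ as the $i$-th argument of $f$, is a Hochschild coboundary. -/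

import Mathlib

open scoped TensorProduct
open MulOpposite

/-! ### Hochschild cochains with coefficients in a bimodule -/

section Hochschild

/-- The enveloping algebra `A ⊗ Aᵒᵖ`. -/
abbrev Env (K A : Type*) [Field K] [Ring A] [Algebra K A] : Type _ := A ⊗[K] Aᵐᵒᵖ

/-- `A` as a module over its enveloping algebra: `(a ⊗ b) • r = a * r * b`. -/
instance envModuleSelf (K A : Type*) [Field K] [Ring A] [Algebra K A] : Module (Env K A) A :=
  TensorProduct.Algebra.module

theorem env_tmul_smul {K A : Type*} [Field K] [Ring A] [Algebra K A] (a b r : A) :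
    (a ⊗ₜ[K] op b : Env K A) • r = a * r * b := by
  change a * (r * b) = a * r * b
  rw [mul_assoc]

instance envIsScalarTowerSelf (K A : Type*) [Field K] [Ring A] [Algebra K A] :
    IsScalarTower K (Env K A) A where
  smul_assoc := fun r ab a => by
    change TensorProduct.Algebra.moduleAux _ _ = _ • TensorProduct.Algebra.moduleAux _ _
    simp

/-- `n`-cochains: `K`-multilinear maps `Aⁿ → M`, that is, `Hom_K(A^{⊗ n}, M)`.  Sending `f` to
`a₀ ⊗ a₁ ⊗ ⋯ ⊗ aₙ ⊗ aₙ₊₁ ↦ a₀ f(a₁, …, aₙ) aₙ₊₁` identifies them with the bimodule maps from the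
bar resolution term `A ⊗ A^{⊗ n} ⊗ A` to `M`. -/
abbrev Cochain (K A M : Type*) [Field K] [Ring A] [Algebra K A] [AddCommGroup M] [Module K M]
    (n : ℕ) : Type _ :=
  MultilinearMap K (fun _ : Fin n => A) M

instance cochainAddCommGroup (K A M : Type*) [Field K] [Ring A] [Algebra K A] [AddCommGroup M]
    [Module K M] (n : ℕ) : AddCommGroup (Cochain K A M n) :=
  inferInstance

/-- Precomposition of a multilinear map with a substitution `T` of the arguments that is linear
in each variable. -/
def substitute {K A M : Type*} [Field K] [Ring A] [Algebra K A] [AddCommGroup M] [Module K M]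
    {n p : ℕ} (f : Cochain K A M n) (T : (Fin p → A) → (Fin n → A))
    (hT : ∀ (a : Fin p → A) (l : Fin p), ∃ (k : Fin n) (φ : A →ₗ[K] A),
      ∀ v, T (Function.update a l v) = Function.update (T a) k (φ v)) :
    Cochain K A M p where
  toFun a := f (T a)
  map_update_add' := by
    intro inst a l u v
    obtain rfl := Subsingleton.elim inst (instDecidableEqFin p)
    obtain ⟨k, φ, h⟩ := hT a l
    simp only [h, map_add, f.map_update_add]
  map_update_smul' := by
    intro inst a l c v
    obtain rfl := Subsingleton.elim inst (instDecidableEqFin p)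
    obtain ⟨k, φ, h⟩ := hT a l
    simp only [h, map_smul, f.map_update_smul]

@[simp]
theorem substitute_apply {K A M : Type*} [Field K] [Ring A] [Algebra K A] [AddCommGroup M]
    [Module K M] {n p : ℕ} (f : Cochain K A M n) (T : (Fin p → A) → (Fin n → A)) (hT)
    (a : Fin p → A) : substitute f T hT a = f (T a) := rfl

theorem contractNth_update {K A : Type*} [Field K] [Ring A] [Algebra K A] {n : ℕ} (j : Fin n)
    (a : Fin (n + 1) → A) (l : Fin (n + 1)) :
    ∃ (k : Fin n) (φ : A →ₗ[K] A), ∀ v,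
      Fin.contractNth j.castSucc (· * ·) (Function.update a l v)
        = Function.update (Fin.contractNth j.castSucc (· * ·) a) k (φ v) := by
  rcases lt_trichotomy (l : ℕ) j with h | h | h
  · refine ⟨⟨l, by omega⟩, LinearMap.id, fun v => funext fun i => ?_⟩
    simp only [Fin.contractNth, Function.update_apply, Fin.ext_iff, Fin.val_castSucc,
      Fin.val_succ, LinearMap.id_apply]
    split_ifs <;> first | rfl | omega
  · refine ⟨j, LinearMap.mulRight K (a j.succ), fun v => funext fun i => ?_⟩
    simp only [Fin.contractNth, Function.update_apply, Fin.ext_iff, Fin.val_castSucc,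
      Fin.val_succ, LinearMap.mulRight_apply]
    split_ifs with h1 h2 h3 h4 h5 h6 <;> first | rfl | omega | skip
    all_goals
      obtain rfl : i = j := Fin.ext (by omega)
      rfl
  · by_cases h' : (l : ℕ) = j + 1
    · refine ⟨j, LinearMap.mulLeft K (a j.castSucc), fun v => funext fun i => ?_⟩
      simp only [Fin.contractNth, Function.update_apply, Fin.ext_iff, Fin.val_castSucc,
        Fin.val_succ, LinearMap.mulLeft_apply]
      split_ifs with h1 h2 h3 h4 h5 h6 <;> first | rfl | omega | skip
      all_goals
        obtain rfl : i = j := Fin.ext (by omega)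
        rfl
    · refine ⟨⟨l - 1, by omega⟩, LinearMap.id, fun v => funext fun i => ?_⟩
      simp only [Fin.contractNth, Function.update_apply, Fin.ext_iff, Fin.val_castSucc,
        Fin.val_succ, LinearMap.id_apply]
      split_ifs <;> first | rfl | omega

/-- The term `f(a₀, …, a_j a_{j+1}, …, aₙ)` of the Hochschild differential. -/
def faceInner {K A M : Type*} [Field K] [Ring A] [Algebra K A] [AddCommGroup M] [Module K M]
    {n : ℕ} (j : Fin n) (f : Cochain K A M n) : Cochain K A M (n + 1) :=
  substitute f (Fin.contractNth j.castSucc (· * ·)) (contractNth_update j)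

/-- The term `a₀ f(a₁, …, aₙ)` of the Hochschild differential. -/
def faceFirst {K A M : Type*} [Field K] [Ring A] [Algebra K A] [AddCommGroup M] [Module K M]
    [Module (Env K A) M] [IsScalarTower K (Env K A) M]
    {n : ℕ} (f : Cochain K A M n) : Cochain K A M (n + 1) where
  toFun a := (a 0 ⊗ₜ[K] op (1 : A) : Env K A) • f (Fin.tail a)
  map_update_add' := by
    intro inst a l u v
    obtain rfl := Subsingleton.elim inst (instDecidableEqFin _)
    refine Fin.cases ?_ (fun i => ?_) l
    · simp [Fin.tail_update_zero, TensorProduct.add_tmul, add_smul]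
    · simp [Fin.tail_update_succ, Function.update_of_ne (Fin.succ_ne_zero i).symm]
  map_update_smul' := by
    intro inst a l c v
    obtain rfl := Subsingleton.elim inst (instDecidableEqFin _)
    refine Fin.cases ?_ (fun i => ?_) l
    · simp [Fin.tail_update_zero, ← TensorProduct.smul_tmul']
    · simp [Fin.tail_update_succ, Function.update_of_ne (Fin.succ_ne_zero i).symm,
        smul_comm _ c]

/-- The term `f(a₀, …, aₙ₋₁) aₙ` of the Hochschild differential. -/
def faceLast {K A M : Type*} [Field K] [Ring A] [Algebra K A] [AddCommGroup M] [Module K M]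
    [Module (Env K A) M] [IsScalarTower K (Env K A) M]
    {n : ℕ} (f : Cochain K A M n) : Cochain K A M (n + 1) where
  toFun a := ((1 : A) ⊗ₜ[K] op (a (Fin.last n)) : Env K A) • f (Fin.init a)
  map_update_add' := by
    intro inst a l u v
    obtain rfl := Subsingleton.elim inst (instDecidableEqFin _)
    refine Fin.lastCases ?_ (fun i => ?_) l
    · simp [Fin.init_update_last, TensorProduct.tmul_add, add_smul]
    · simp [Fin.init_update_castSucc, Function.update_of_ne (Fin.castSucc_lt_last i).ne']
  map_update_smul' := by
    intro inst a l c v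
    obtain rfl := Subsingleton.elim inst (instDecidableEqFin _)
    refine Fin.lastCases ?_ (fun i => ?_) l
    · simp [Fin.init_update_last]
    · simp [Fin.init_update_castSucc, Function.update_of_ne (Fin.castSucc_lt_last i).ne',
        smul_comm _ c]

/-- The Hochschild differential
`(δf)(a₀, …, aₙ) = a₀ f(a₁, …, aₙ) + ∑ⱼ (-1)^{j+1} f(…, aⱼ aⱼ₊₁, …) + (-1)^{n+1} f(a₀, …, aₙ₋₁) aₙ`.
Under the identification of `Cochain K A M n` with bimodule maps out of the bar resolution, it is
precomposition with the bar differential. -/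
def hochschildD (K A M : Type*) [Field K] [Ring A] [Algebra K A] [AddCommGroup M] [Module K M]
    [Module (Env K A) M] [IsScalarTower K (Env K A) M] (n : ℕ) :
    Cochain K A M n →ₗ[K] Cochain K A M (n + 1) where
  toFun f := faceFirst f + ∑ j : Fin n, (-1 : K) ^ ((j : ℕ) + 1) • faceInner j f
    + (-1 : K) ^ (n + 1) • faceLast f
  map_add' f g := by
    ext a
    simp only [faceFirst, faceInner, faceLast, add_apply, smul_apply,
      sum_apply, substitute_apply, MultilinearMap.coe_mk, smul_add,
      Finset.sum_add_distrib]
    abel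
  map_smul' c f := by
    ext a
    simp only [faceFirst, faceInner, faceLast, add_apply, smul_apply,
      sum_apply, substitute_apply, MultilinearMap.coe_mk, smul_add,
      Finset.smul_sum, RingHom.id_apply, smul_comm c]

theorem hochschildD_apply {K A M : Type*} [Field K] [Ring A] [Algebra K A] [AddCommGroup M]
    [Module K M] [Module (Env K A) M] [IsScalarTower K (Env K A) M] (n : ℕ)
    (f : Cochain K A M n) (a : Fin (n + 1) → A) :
    hochschildD K A M n f a = (a 0 ⊗ₜ[K] op (1 : A) : Env K A) • f (Fin.tail a)
      + ∑ j : Fin n, (-1 : K) ^ ((j : ℕ) + 1) • f (Fin.contractNth j.castSucc (· * ·) a)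
      + (-1 : K) ^ (n + 1) •
        (((1 : A) ⊗ₜ[K] op (a (Fin.last n)) : Env K A) • f (Fin.init a)) := by
  simp [hochschildD, faceFirst, faceInner, faceLast]

/-- Hochschild cocycles of `A` with coefficients in `A`. -/
def cocycles (K A : Type*) [Field K] [Ring A] [Algebra K A] (n : ℕ) :
    Submodule K (Cochain K A A n) :=
  LinearMap.ker (hochschildD K A A n)

/-- Hochschild coboundaries of `A` with coefficients in `A`. -/
def coboundaries (K A : Type*) [Field K] [Ring A] [Algebra K A] :
    (n : ℕ) → Submodule K (Cochain K A A n)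
  | 0 => ⊥
  | n + 1 => LinearMap.range (hochschildD K A A n)

/-- The Hochschild cohomology `HHⁿ(A)`. -/
abbrev HH (K A : Type*) [Field K] [Ring A] [Algebra K A] (n : ℕ) : Type _ :=
  cocycles K A n ⧸ (coboundaries K A n).submoduleOf (cocycles K A n)

/-- The class of a cocycle in `HHⁿ(A)`. -/
def HH.mk {K A : Type*} [Field K] [Ring A] [Algebra K A] {n : ℕ} (f : cocycles K A n) :
    HH K A n :=
  Submodule.Quotient.mk f

/-! ### The Gerstenhaber bracket -/

/-- The argument list `(a₀, …, aᵢ₋₁, g(aᵢ, …, aᵢ₊ₘ₋₁), aᵢ₊ₘ, …)` of length `n`, where the given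
list has length `p = n + m - 1`. -/
def insertAt {K A : Type*} [Field K] [Ring A] [Algebra K A] {n m p : ℕ} (h : p + 1 = n + m)
    (i : Fin n) (g : Cochain K A A m) (a : Fin p → A) : Fin n → A := fun j =>
  if h₁ : (j : ℕ) < i then a ⟨j, by omega⟩
  else if h₂ : (j : ℕ) = i then g (fun k => a ⟨i + k, by omega⟩)
  else a ⟨j + m - 1, by omega⟩

theorem insertAt_update {K A : Type*} [Field K] [Ring A] [Algebra K A] {n m p : ℕ}
    (h : p + 1 = n + m) (i : Fin n) (g : Cochain K A A m) (a : Fin p → A) (l : Fin p) :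
    ∃ (k : Fin n) (φ : A →ₗ[K] A), ∀ v,
      insertAt h i g (Function.update a l v) = Function.update (insertAt h i g a) k (φ v) := by
  by_cases h₁ : (l : ℕ) < i
  · refine ⟨⟨l, by omega⟩, LinearMap.id, fun v => funext fun j => ?_⟩
    have hg : (fun k : Fin m => Function.update a l v ⟨i + k, by omega⟩)
        = fun k : Fin m => a ⟨i + k, by omega⟩ := by
      funext k
      rw [Function.update_of_ne]
      simp only [ne_eq, Fin.ext_iff]
      omega
    simp only [insertAt, hg]
    simp only [Function.update_apply, Fin.ext_iff, LinearMap.id_apply, insertAt]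
    split_ifs <;> first | rfl | omega
  · by_cases h₂ : (l : ℕ) < i + m
    · refine ⟨i, g.toLinearMap (fun k => a ⟨i + k, by omega⟩) ⟨l - i, by omega⟩,
        fun v => funext fun j => ?_⟩
      have hg : (fun k : Fin m => Function.update a l v ⟨i + k, by omega⟩)
          = Function.update (fun k : Fin m => a ⟨i + k, by omega⟩) ⟨l - i, by omega⟩ v := by
        funext k
        simp only [Function.update_apply, Fin.ext_iff]
        split_ifs <;> first | rfl | omega
      simp only [insertAt, hg, MultilinearMap.toLinearMap_apply]
      simp only [Function.update_apply (insertAt h i g a), Fin.ext_iff]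
      simp only [Function.update_apply a, Fin.ext_iff, insertAt]
      split_ifs <;> first | rfl | omega
    · refine ⟨⟨l + 1 - m, by omega⟩, LinearMap.id, fun v => funext fun j => ?_⟩
      have hg : (fun k : Fin m => Function.update a l v ⟨i + k, by omega⟩)
          = fun k : Fin m => a ⟨i + k, by omega⟩ := by
        funext k
        rw [Function.update_of_ne]
        simp only [ne_eq, Fin.ext_iff]
        omega
      simp only [insertAt, hg]
      simp only [Function.update_apply, Fin.ext_iff, LinearMap.id_apply, insertAt]
      split_ifs <;> first | rfl | omega

/-- `f ∘ᵢ g` (with `i` counted from `0`). -/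
def circAt {K A : Type*} [Field K] [Ring A] [Algebra K A] {n m p : ℕ} (h : p + 1 = n + m)
    (i : Fin n) (f : Cochain K A A n) (g : Cochain K A A m) : Cochain K A A p :=
  substitute f (insertAt h i g) (insertAt_update h i g)

/-- `f ∘ g = ∑ᵢ (-1)^{(m-1) i} f ∘ᵢ g`, with `i` counted from `0`; the exponent is written with
`m + 1`, of the same parity as `m - 1`. -/
def circ {K A : Type*} [Field K] [Ring A] [Algebra K A] {n m p : ℕ} (h : p + 1 = n + m)
    (f : Cochain K A A n) (g : Cochain K A A m) : Cochain K A A p :=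
  ∑ i : Fin n, (-1 : K) ^ ((m + 1) * (i : ℕ)) • circAt h i f g

/-- The Gerstenhaber bracket `[f, g] = f ∘ g - (-1)^{(n-1)(m-1)} g ∘ f` of cochains of degrees `n`
and `m`, a cochain of degree `p = n + m - 1`. -/
def gerstenhaber {K A : Type*} [Field K] [Ring A] [Algebra K A] {n m p : ℕ} (h : p + 1 = n + m)
    (f : Cochain K A A n) (g : Cochain K A A m) : Cochain K A A p :=
  circ h f g - (-1 : K) ^ ((n + 1) * (m + 1)) • circ (h.trans (Nat.add_comm n m)) g f

/-- `γ` is the Gerstenhaber bracket `[α, β]` in Hochschild cohomology: for all cocycles `f`, `g`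
representing `α`, `β`, the cochain `[f, g]` is a cocycle and represents `γ`. -/
def IsGerstenhaberBracket {K A : Type*} [Field K] [Ring A] [Algebra K A] {n m p : ℕ}
    (h : p + 1 = n + m) (α : HH K A n) (β : HH K A m) (γ : HH K A p) : Prop :=
  ∀ (f : cocycles K A n) (g : cocycles K A m), HH.mk f = α → HH.mk g = β →
    ∃ hc : gerstenhaber h (f : Cochain K A A n) (g : Cochain K A A m) ∈ cocycles K A p,
      HH.mk ⟨_, hc⟩ = γ

end Hochschild

/-! ### The algebra `R(2, 0, d)` -/

section AlgebraR

/-- The relations `X² + YXY`, `Y² + XYX + d(XY)²`, `X(YX)²`, `Y(XY)²` on the free algebra on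
`X = ι 0` and `Y = ι 1`. -/
inductive RRel (K : Type*) [Field K] (d : K) :
    FreeAlgebra K (Fin 2) → FreeAlgebra K (Fin 2) → Prop
  | r1 {X Y : FreeAlgebra K (Fin 2)} (hX : X = FreeAlgebra.ι K 0) (hY : Y = FreeAlgebra.ι K 1) :
      RRel K d (X ^ 2 + Y * X * Y) 0
  | r2 {X Y : FreeAlgebra K (Fin 2)} (hX : X = FreeAlgebra.ι K 0) (hY : Y = FreeAlgebra.ι K 1) :
      RRel K d (Y ^ 2 + X * Y * X + d • (X * Y) ^ 2) 0
  | r3 {X Y : FreeAlgebra K (Fin 2)} (hX : X = FreeAlgebra.ι K 0) (hY : Y = FreeAlgebra.ι K 1) :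
      RRel K d (X * (Y * X) ^ 2) 0
  | r4 {X Y : FreeAlgebra K (Fin 2)} (hX : X = FreeAlgebra.ι K 0) (hY : Y = FreeAlgebra.ι K 1) :
      RRel K d (Y * (X * Y) ^ 2) 0

/-- The algebra `R(2, 0, d) = K⟨X, Y⟩ / ⟨X² + YXY, Y² + XYX + d(XY)², X(YX)², Y(XY)²⟩`. -/
abbrev R20 (K : Type*) [Field K] (d : K) : Type _ := RingQuot (RRel K d)

namespace R20

/-- The class of `X` in `R(2, 0, d)`. -/
def x (K : Type*) [Field K] (d : K) : R20 K d :=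
  RingQuot.mkAlgHom K (RRel K d) (FreeAlgebra.ι K 0)

/-- The class of `Y` in `R(2, 0, d)`. -/
def y (K : Type*) [Field K] (d : K) : R20 K d :=
  RingQuot.mkAlgHom K (RRel K d) (FreeAlgebra.ι K 1)

section Relations

variable {K : Type*} [Field K] (d : K)

theorem rel1 : x K d * x K d + y K d * x K d * y K d = 0 := by
  simpa [x, y, sq] using RingQuot.mkAlgHom_rel K (RRel.r1 (d := d) (K := K) rfl rfl)

theorem rel2 : y K d * y K d + x K d * y K d * x K d
    + d • (x K d * y K d * (x K d * y K d)) = 0 := by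
  simpa [x, y, sq] using RingQuot.mkAlgHom_rel K (RRel.r2 (d := d) (K := K) rfl rfl)

theorem rel3 : x K d * (y K d * x K d * (y K d * x K d)) = 0 := by
  simpa [x, y, sq] using RingQuot.mkAlgHom_rel K (RRel.r3 (d := d) (K := K) rfl rfl)

theorem rel4 : y K d * (x K d * y K d * (x K d * y K d)) = 0 := by
  simpa [x, y, sq] using RingQuot.mkAlgHom_rel K (RRel.r4 (d := d) (K := K) rfl rfl)

theorem add_self [CharP K 2] (a : R20 K d) : a + a = 0 := by
  have h : (2 : K) = 0 := CharTwo.two_eq_zero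
  have h' : (2 : K) • a = 0 := by rw [h, zero_smul]
  rwa [two_smul] at h'

theorem eq_of_add_eq_zero' [CharP K 2] {a b : R20 K d} (h : a + b = 0) : a = b := by
  have h1 : a + b + b = b := by rw [h, zero_add]
  rwa [add_assoc, add_self, add_zero] at h1

theorem xyxyx : x K d * (y K d * (x K d * (y K d * x K d))) = 0 := by
  simpa only [mul_assoc] using rel3 d

theorem yxyxy : y K d * (x K d * (y K d * (x K d * y K d))) = 0 := by
  simpa only [mul_assoc] using rel4 d

theorem xx [CharP K 2] : x K d * x K d = y K d * (x K d * y K d) := by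
  rw [eq_of_add_eq_zero' d (rel1 d), mul_assoc]

theorem yy [CharP K 2] : y K d * y K d
    = x K d * (y K d * x K d) + d • (x K d * (y K d * (x K d * y K d))) := by
  have h := rel2 d
  rw [add_assoc] at h
  rw [eq_of_add_eq_zero' d h]
  simp only [mul_assoc]

theorem yxyx [CharP K 2] :
    y K d * (x K d * (y K d * x K d)) = x K d * (y K d * (x K d * y K d)) := by
  have h : x K d * x K d * x K d = x K d * (x K d * x K d) := mul_assoc _ _ _
  rw [xx] at h
  simpa only [mul_assoc] using h

theorem yyy [CharP K 2] : y K d * (y K d * y K d) = y K d * (x K d * (y K d * x K d)) := by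
  rw [yy, mul_add, mul_smul_comm, yxyxy, smul_zero, add_zero]

theorem yyx [CharP K 2] : y K d * (y K d * x K d) = 0 := by
  have h1 : y K d * (y K d * x K d) = x K d * (y K d * y K d) * (x K d * y K d) := by
    conv_lhs => rw [← mul_assoc, yy, add_mul, smul_mul_assoc]
    simp only [mul_assoc, xyxyx, xx, smul_zero, add_zero]
  have h2 : x K d * (y K d * y K d) * (x K d * y K d)
      = x K d * x K d * (y K d * (x K d * x K d * y K d))
        + d • (x K d * (x K d * (y K d * (x K d * (y K d * x K d)))) * y K d) := by
    rw [yy, mul_add, add_mul, mul_smul_comm, smul_mul_assoc]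
    simp only [mul_assoc]
  have h3 : x K d * x K d * (y K d * (x K d * x K d * y K d))
      = y K d * x K d * (y K d * (y K d * y K d)) * x K d * y K d * y K d := by
    rw [xx]
    simp only [mul_assoc]
  have h4 : y K d * x K d * (y K d * (x K d * (y K d * x K d))) * x K d * y K d * y K d
      = y K d * (x K d * (y K d * (x K d * (y K d * x K d)))) * x K d * y K d * y K d := by
    simp only [mul_assoc]
  rw [h1, h2, h3, yyy, h4, xyxyx]
  simp only [mul_zero, zero_mul, smul_zero, add_zero]

theorem xxyx [CharP K 2] : x K d * (x K d * (y K d * x K d)) = 0 := by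
  rw [← mul_assoc, xx]
  simp only [mul_assoc, yyx, mul_zero]

theorem xyy [CharP K 2] : x K d * (y K d * y K d) = 0 := by
  have h : x K d * (x K d * (y K d * (x K d * y K d)))
      = x K d * (x K d * (y K d * x K d)) * y K d := by
    simp only [mul_assoc]
  rw [yy, mul_add, mul_smul_comm, xxyx, h, xxyx, zero_mul, smul_zero, add_zero]

end Relations

/-- The element `a ⊗ b` of the enveloping algebra of `R(2, 0, d)`; multiplying by it on the right
sends `u ⊗ v` to `ua ⊗ bv`. -/
def tens {K : Type*} [Field K] {d : K} (a b : R20 K d) : Env K (R20 K d) := a ⊗ₜ[K] op b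

/-- Ranks of the terms of the `4`-periodic resolution. -/
def rk : ℕ → ℕ
  | 0 => 1
  | 1 => 2
  | 2 => 2
  | 3 => 1
  | n + 4 => rk n

/-- The terms of the resolution: `Pₙ = Λ^{rk n}` with `Λ` the enveloping algebra.  The generators
of `P₁` are indexed by `x, y`, those of `P₂` by the relations `r_x, r_y`. -/
abbrev P (K : Type*) [Field K] (d : K) (n : ℕ) : Type _ := Fin (rk n) → Env K (R20 K d)

/-- Matrices of the differentials `Pₙ₊₁ → Pₙ`.  The `j`-th row is the image of the `j`-th
generator. -/
def dMat (K : Type*) [Field K] (d : K) :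
    (n : ℕ) → Matrix (Fin (rk (n + 1))) (Fin (rk n)) (Env K (R20 K d))
  | 0 =>
    let x := x K d
    let y := y K d
    !![tens x 1 + tens 1 x;
       tens y 1 + tens 1 y]
  | 1 =>
    let x := x K d
    let y := y K d
    !![tens x 1 + tens 1 x + tens y y,
       tens 1 (x * y) + tens (y * x) 1;
       tens 1 (y * x) + tens (x * y) 1 + d • tens 1 (y * x * y) + d • tens (x * y) y,
       tens y 1 + tens 1 y + tens x x + d • tens x (x * y) + d • tens (x * y * x) 1]
  | 2 =>
    let x := x K d
    let y := y K d
    !![tens x 1 + tens 1 x,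
       tens y 1 + tens 1 y + d • tens y y + d • tens 1 (x * y * x) + d ^ 2 • tens y (x * y * x)]
  | 3 =>
    let x := x K d
    let y := y K d
    !![tens 1 (x * y * x * y) + tens (x * y) (x * y) + tens (x * y * x * y) 1
       + tens (y * x) (y * x)
       + tens y (x * y * x) + tens (y * x * y) x
       + tens x (y * x * y) + tens (x * y * x) y
       + d • tens (x * y * x) (x * y * x)]
  | n + 4 => dMat K d n

/-- The differential `Pₙ₊₁ → Pₙ`, a map of left modules over the enveloping algebra. -/
def diff (K : Type*) [Field K] (d : K) (n : ℕ) : P K d (n + 1) →ₗ[Env K (R20 K d)] P K d n :=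
  (dMat K d n).vecMulLinear

/-- The homomorphism `Pₙ → R` with prescribed values on the generators. -/
def ofValues {K : Type*} [Field K] {d : K} (n : ℕ) (r : Fin (rk n) → R20 K d) :
    P K d n →ₗ[Env K (R20 K d)] R20 K d :=
  Fintype.linearCombination (Env K (R20 K d)) r

/-- The augmentation `P₀ = R ⊗ R → R`, `a ⊗ b ↦ ab`. -/
def aug (K : Type*) [Field K] (d : K) : P K d 0 →ₗ[Env K (R20 K d)] R20 K d :=
  ofValues 0 (![1] : Fin 1 → R20 K d)

/-- A comparison morphism from the bar resolution of `R` to the resolution `P`: a morphism of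
complexes of bimodules lifting the identity of `R`.  A bimodule map `R ⊗ R^{⊗ n} ⊗ R → Pₙ` is given
by its values `toFun n a = Ψₙ(1 ⊗ a₁ ⊗ ⋯ ⊗ aₙ ⊗ 1)`. -/
structure Comparison (K : Type*) [Field K] (d : K) where
  /-- The components `Ψₙ`. -/
  toFun : (n : ℕ) → Cochain K (R20 K d) (P K d n) n
  /-- `Ψ₀` lifts the identity of `R`. -/
  aug_zero : ∀ a : Fin 0 → R20 K d, aug K d (toFun 0 a) = 1
  /-- `d ∘ Ψₙ₊₁ = Ψₙ ∘ d`. -/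
  comm : ∀ (n : ℕ) (a : Fin (n + 1) → R20 K d),
    diff K d n (toFun (n + 1) a) = hochschildD K (R20 K d) (P K d n) n (toFun n) a

/-- The `n`-cocycles of the complex `Hom_Λ(P, R)`. -/
abbrev CocycleP (K : Type*) [Field K] (d : K) (n : ℕ) : Type _ :=
  {c : P K d n →ₗ[Env K (R20 K d)] R20 K d // c ∘ₗ diff K d n = 0}

/-- The Hochschild cochain `c ∘ Ψₙ`. -/
def Comparison.pull {K : Type*} [Field K] {d : K} (Ψ : Comparison K d) {n : ℕ}
    (c : P K d n →ₗ[Env K (R20 K d)] R20 K d) : Cochain K (R20 K d) (R20 K d) n :=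
  (c.restrictScalars K).compMultilinearMap (Ψ.toFun n)

theorem Comparison.pull_mem {K : Type*} [Field K] {d : K} (Ψ : Comparison K d) {n : ℕ}
    (c : CocycleP K d n) : Ψ.pull c.1 ∈ cocycles K (R20 K d) n := by
  refine LinearMap.mem_ker.2 (MultilinearMap.ext fun a => ?_)
  have h1 : hochschildD K (R20 K d) (R20 K d) n (Ψ.pull c.1) a
      = c.1 (hochschildD K (R20 K d) (P K d n) n (Ψ.toFun n) a) := by
    have hs : ∀ (r : K) (z : P K d n), c.1 (r • z) = r • c.1 z :=
      fun r z => (c.1.restrictScalars K).map_smul r z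
    simp only [hochschildD_apply, pull, map_add, map_sum, hs, map_smul,
      LinearMap.compMultilinearMap_apply, LinearMap.coe_restrictScalars]
  rw [h1, ← Ψ.comm]
  exact LinearMap.congr_fun c.2 _

/-- The class in `HHⁿ(R)` of a cocycle of `Hom_Λ(P, R)`, transported along a comparison
morphism. -/
def Comparison.toHH {K : Type*} [Field K] {d : K} (Ψ : Comparison K d) {n : ℕ}
    (c : CocycleP K d n) : HH K (R20 K d) n :=
  HH.mk ⟨Ψ.pull c.1, Ψ.pull_mem c⟩

theorem ofValues_comp_diff {K : Type*} [Field K] {d : K} (n : ℕ) (r : Fin (rk n) → R20 K d)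
    (h : ∀ j, ∑ i, dMat K d n j i • r i = 0) : ofValues n r ∘ₗ diff K d n = 0 := by
  refine LinearMap.ext fun z => ?_
  have : ofValues n r (diff K d n z) = ∑ j, z j • ∑ i, dMat K d n j i • r i := by
    simp only [ofValues, diff, Fintype.linearCombination_apply, Matrix.vecMulLinear_apply,
      Matrix.vecMul, dotProduct, Finset.sum_smul, Finset.smul_sum, mul_smul]
    exact Finset.sum_comm
  simp [this, h]

theorem tens_smul {K : Type*} [Field K] {d : K} (a b r : R20 K d) :
    tens a b • r = a * (r * b) := by
  rw [tens, env_tmul_smul, mul_assoc]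

/-- `w₁ = (x, 0)`, as a homomorphism `P₂ → R`. -/
def w₁ (K : Type*) [Field K] [CharP K 2] (d : K) : CocycleP K d 2 :=
  ⟨ofValues 2 (![x K d, 0] : Fin 2 → R20 K d), by
    refine ofValues_comp_diff _ _ ?_
    change ∀ j : Fin 1, ∑ i : Fin 2, dMat K d 2 j i • (![x K d, 0] : Fin 2 → R20 K d) i = 0
    intro j
    fin_cases j
    simp [Fin.sum_univ_two, dMat, add_smul, tens_smul, add_self]⟩

/-- `w₂ = (0, y)`, as a homomorphism `P₂ → R`. -/
def w₂ (K : Type*) [Field K] [CharP K 2] (d : K) : CocycleP K d 2 :=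
  ⟨ofValues 2 (![0, y K d] : Fin 2 → R20 K d), by
    refine ofValues_comp_diff _ _ ?_
    change ∀ j : Fin 1, ∑ i : Fin 2, dMat K d 2 j i • (![0, y K d] : Fin 2 → R20 K d) i = 0
    intro j
    fin_cases j
    have h : y K d * (y K d * (x K d * (y K d * x K d))) = 0 := by rw [yxyx, yxyxy]
    simp [Fin.sum_univ_two, dMat, add_smul, tens_smul, add_self, mul_assoc, yyy, h]⟩

/-- `w₃ = (y, x + dxy)`, as a homomorphism `P₂ → R`. -/
def w₃ (K : Type*) [Field K] [CharP K 2] (d : K) : CocycleP K d 2 :=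
  ⟨ofValues 2 (![y K d, x K d + d • (x K d * y K d)] : Fin 2 → R20 K d), by
    refine ofValues_comp_diff _ _ ?_
    change ∀ j : Fin 1, ∑ i : Fin 2, dMat K d 2 j i • (![y K d, x K d + d • (x K d * y K d)] : Fin 2 → R20 K d) i = 0
    intro j
    fin_cases j
    simp [Fin.sum_univ_two, dMat, add_smul, tens_smul, mul_assoc, xxyx, xyy,
      xyxyx]
    linear_combination (norm := module) add_self d (x K d * y K d)
      + add_self d (y K d * x K d) + d • add_self d (y K d * (x K d * y K d))⟩

/-- `e = 1`, as a homomorphism `P₄ → R`. -/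
def e (K : Type*) [Field K] [CharP K 2] (d : K) : CocycleP K d 4 :=
  ⟨ofValues 4 (![1] : Fin 1 → R20 K d), by
    refine ofValues_comp_diff _ _ ?_
    change ∀ j : Fin 2, ∑ i : Fin 1, dMat K d 4 j i • (![1] : Fin 1 → R20 K d) i = 0
    intro j
    fin_cases j <;> simp [dMat, add_smul, tens_smul, add_self]⟩

end R20

end AlgebraR

/-!
All signs disappear in characteristic `2`, and the argument is a deformation argument.

Let `f` be a Hochschild cocycle representing `w = c₁w₁ + c₂w₂ + c₃w₃`. It defines a first-order
deformation `R ⊕ εR` of `R = R(2, 0, d)`, an algebra over the dual numbers `K[ε]`. If a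
representative `g` of `e` extends to a Hochschild cocycle `G` of this deformation, then the
`ε`-part `h` of `G` satisfies `δh = [f, g]`: this is the `ε`-part of the cocycle identity for `G`
(`NormalizedCocycle.Deform.gerstenhaber_mem_range`). So it suffices to extend the cocycle of `e`.

For that the resolution `P` is deformed together with the algebra. The deformation of `R` along
`f` is given by the relations `x² = yxy + ε(c₁x + c₃y)` and
`y² = xyx + d(xy)² + ε(c₂y + c₃(x + dxy))`, with corresponding changes of the other products of
words (`R20.deformedRelations_wCocycle`), and the differentials of `P` have lifts `deformedMat`
to the enveloping algebra of the deformation that still compose to zero. The lift of `d₄ = d₀`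
has the entries `x ⊗ 1 + 1 ⊗ x` and `y ⊗ 1 + 1 ⊗ y`, which kill `1`; hence the map that takes the
value `1` on the generator in degree four is a cocycle of the deformed complex
(`R20.deformAug_four_diff`). Composed with a comparison morphism of the deformation that reduces
modulo `ε` to one of `R` (`R20.deformDiff_deformComparison`, `R20.reduce_deformComparison`), it is
the required extension of the cocycle of `e` (`R20.gerstenhaber_wComb_e`).

Comparison morphisms come from contractions. A left-linear contraction `t` of an augmented complex
of bimodules determines a chain map from the bar resolution by the recursion
`Ψₙ₊₁(a₁, …, aₙ₊₁) = t(Ψₙ(a₁, …, aₙ) aₙ₊₁)` (`diff_barLift`), and a similar recursion gives a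
homotopy from it to any other chain map over the identity (`diff_barHomotopy`). For `P` such a
contraction is written down on the basis of the eight words `1, x, y, xy, yx, xyx, yxy, xyxy`
of `R` (`R20.contrCoef`, `R20.diff_contr`). Therefore the class of the cocycle of any `c` in
`Hom(P, R)` does not depend on the comparison morphism (`R20.Comparison.toHH_eq`). For the deformed
complex, a linear lift `t` of the contraction satisfies `Dt + tD = 1 + O(ε)`. The endomorphism
`c = Dt + tD` commutes with `D` and satisfies `c² = 1`, since `2 = 0` and `ε² = 0`; so `tc` is a
contraction.

Finally, the choice of the representatives `f` and `g` does not matter, because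
`[f, δv] = δ[f, v]` and `[δu, g] = δ[u, g]` for cocycles `f` of degree two and `g` of degree four
(`hochschildD_bracket_two_three`, `hochschildD_bracket_one_four`).
-/

/-! ### The basis of words -/

namespace R20

variable {K : Type*} [Field K] {d : K}

theorem xxy [CharP K 2] : x K d * (x K d * y K d) = 0 := by
  rw [← mul_assoc, xx]
  simp only [mul_assoc, xyy, mul_zero]

theorem xxyxy [CharP K 2] : x K d * (x K d * (y K d * (x K d * y K d))) = 0 := by
  have h : x K d * (x K d * (y K d * (x K d * y K d)))
      = x K d * (x K d * (y K d * x K d)) * y K d := by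
    simp only [mul_assoc]
  rw [h, xxyx, zero_mul]

theorem yyxy [CharP K 2] : y K d * (y K d * (x K d * y K d)) = 0 := by
  have h : y K d * (y K d * (x K d * y K d)) = y K d * (y K d * x K d) * y K d := by
    simp only [mul_assoc]
  rw [h, yyx, zero_mul]

/-- The eight words `1, x, y, xy, yx, xyx, yxy, xyxy` in elements `x`, `y` of an algebra, with
products bracketed to the right. -/
def _root_.shortWord {A : Type*} [Ring A] (x y : A) : Fin 8 → A :=
  ![1, x, y, x * y, y * x, x * (y * x), y * (x * y), x * (y * (x * y))]

/-- Left multiplication by `x` in the coordinates of the eight words. -/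
def leftX (K : Type*) [Field K] : Module.End K (Fin 8 → K) where
  toFun v := ![0, v 0, 0, v 2, 0, v 4, v 1, v 6]
  map_add' u v := by ext i; fin_cases i <;> simp
  map_smul' c v := by ext i; fin_cases i <;> simp

/-- Left multiplication by `y` in the coordinates of the eight words. -/
def leftY (K : Type*) [Field K] (d : K) : Module.End K (Fin 8 → K) where
  toFun v := ![0, 0, v 0, 0, v 1, v 2, v 3, d * v 2 + v 5]
  map_add' u v := by ext i; fin_cases i <;> simp; ring
  map_smul' c v := by ext i; fin_cases i <;> simp; ring

/-- The eight-dimensional representation of `R(2, 0, d)` that turns out to be the left regular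
one. -/
def leftRep (K : Type*) [Field K] [CharP K 2] (d : K) :
    R20 K d →ₐ[K] Module.End K (Fin 8 → K) :=
  RingQuot.liftAlgHom K ⟨FreeAlgebra.lift K ![leftX K, leftY K d], by
    intro u v h
    have h2 : ∀ r : K, r + r = 0 := CharTwo.add_self_eq_zero
    cases h with
    | r1 hX hY =>
      subst hX hY; refine LinearMap.ext fun v => funext fun i => ?_
      fin_cases i <;> simp [leftX, leftY, sq, h2]
    | r2 hX hY =>
      subst hX hY; refine LinearMap.ext fun v => funext fun i => ?_
      fin_cases i <;> simp [leftX, leftY, sq, h2]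
      linear_combination h2 (d * v 0) + h2 (v 2)
    | r3 hX hY =>
      subst hX hY; refine LinearMap.ext fun v => funext fun i => ?_
      fin_cases i <;> simp [leftX, leftY, sq]
    | r4 hX hY =>
      subst hX hY; refine LinearMap.ext fun v => funext fun i => ?_
      fin_cases i <;> simp [leftX, leftY, sq]⟩

theorem leftRep_x [CharP K 2] : leftRep K d (x K d) = leftX K := by
  simp [leftRep, x]

theorem leftRep_y [CharP K 2] : leftRep K d (y K d) = leftY K d := by
  simp [leftRep, y]

/-- `leftRep` describes left multiplication on combinations of the eight words. -/
theorem mul_sum_shortWord [CharP K 2] (r : R20 K d) (v : Fin 8 → K) :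
    r * ∑ i, v i • shortWord (x K d) (y K d) i
      = ∑ i, leftRep K d r v i • shortWord (x K d) (y K d) i := by
  obtain ⟨p, rfl⟩ := RingQuot.mkAlgHom_surjective K (RRel K d) r
  induction p using FreeAlgebra.induction generalizing v with
  | grade0 c =>
    simp [Finset.mul_sum, Algebra.algebraMap_eq_smul_one, smul_smul, mul_comm]
  | grade1 i =>
    fin_cases i
    · change x K d * _ = ∑ i, leftRep K d (x K d) v i • _
      rw [leftRep_x]
      simp [leftX, shortWord, Fin.sum_univ_eight, mul_add, xx, xxy, xxyx, xxyxy]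
      abel
    · change y K d * _ = ∑ i, leftRep K d (y K d) v i • _
      rw [leftRep_y]
      simp [leftY, shortWord, Fin.sum_univ_eight, mul_add, yy, yyx, yxyx, yyxy, yxyxy]
      module
  | mul a b ha hb => simp only [map_mul, mul_assoc, hb, ha, Module.End.mul_apply]
  | add a b ha hb =>
    simp only [map_add, add_mul, hb, ha, LinearMap.add_apply, Pi.add_apply, add_smul,
      Finset.sum_add_distrib]

/-- The eight words form a basis of `R(2, 0, d)`. -/
noncomputable def wordBasis (K : Type*) [Field K] [CharP K 2] (d : K) :
    Module.Basis (Fin 8) K (R20 K d) :=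
  .ofEquivFun
    { toFun := fun r => leftRep K d r ![1, 0, 0, 0, 0, 0, 0, 0]
      map_add' := fun r s => by simp
      map_smul' := fun c r => by simp
      invFun := fun v => ∑ i, v i • shortWord (x K d) (y K d) i
      left_inv := fun r => by
        beta_reduce
        rw [← mul_sum_shortWord, Fin.sum_univ_eight]
        simp [shortWord]
      right_inv := fun v => by
        ext i
        fin_cases i <;> simp [Fin.sum_univ_eight, shortWord, leftRep_x, leftRep_y, leftX, leftY] }

@[simp]
theorem wordBasis_apply [CharP K 2] (i : Fin 8) :
    wordBasis K d i = shortWord (x K d) (y K d) i := by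
  rw [wordBasis, Module.Basis.coe_ofEquivFun]
  change ∑ j, (Pi.single i 1 : Fin 8 → K) j • shortWord (x K d) (y K d) j = _
  simp [Pi.single_apply]

end R20

/-! ### Chain maps and homotopies from a left-linear contraction -/

section Bar

variable (k : Type*) {A M : Type*} [CommRing k] [Ring A] [Algebra k A]

/-- The element `a ⊗ b` of the enveloping algebra of `A` over a commutative ring `k`. The ring `k`
is a field or its dual numbers in the applications. -/
def biTens (a b : A) : A ⊗[k] Aᵐᵒᵖ := a ⊗ₜ[k] op b

theorem biTens_mul (a b a' b' : A) :
    biTens k a b * biTens k a' b' = biTens k (a * a') (b' * b) := by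
  simp [biTens]

theorem biTens_one : biTens k (1 : A) 1 = 1 := rfl

theorem biTens_smul [AddCommGroup M] [Module (A ⊗[k] Aᵐᵒᵖ) M] (a b a' b' : A) (m : M) :
    biTens k a b • biTens k a' b' • m = biTens k (a * a') (b' * b) • m := by
  rw [smul_smul, biTens_mul]

section Plain

variable [AddCommGroup M] [Module (A ⊗[k] Aᵐᵒᵖ) M]

/-- The function `(a₀, …, aₙ) ↦ F(a₀, …, aₙ₋₁) aₙ`. -/
def actLast {n : ℕ} (F : (Fin n → A) → M) (a : Fin (n + 1) → A) : M :=
  biTens k 1 (a (Fin.last n)) • F (Fin.init a)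

/-- The Hochschild differential of a function of `n` variables that need not be linear, without
its signs. -/
def barD {n : ℕ} (F : (Fin n → A) → M) (a : Fin (n + 1) → A) : M :=
  biTens k (a 0) 1 • F (Fin.tail a)
    + ∑ j : Fin n, F (Fin.contractNth j.castSucc (· * ·) a) + actLast k F a

theorem init_contractNth_castSucc {n : ℕ} (j : Fin n) (a : Fin (n + 2) → A) :
    Fin.init (Fin.contractNth j.castSucc.castSucc (· * ·) a)
      = Fin.contractNth j.castSucc (· * ·) (Fin.init a) := by
  funext i
  simp only [Fin.init, Fin.contractNth, Fin.val_castSucc]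
  rfl

theorem contractNth_castSucc_last {n : ℕ} (j : Fin n) (a : Fin (n + 2) → A) :
    Fin.contractNth j.castSucc.castSucc (· * ·) a (Fin.last n) = a (Fin.last (n + 1)) := by
  have h1 : ¬ (n < (j : ℕ)) := by omega
  have h2 : n ≠ (j : ℕ) := by omega
  simp [Fin.contractNth, h1, h2]

theorem init_contractNth_last {n : ℕ} (a : Fin (n + 2) → A) :
    Fin.init (Fin.contractNth (Fin.last n).castSucc (· * ·) a) = Fin.init (Fin.init a) := by
  funext i
  simp [Fin.init, Fin.contractNth]

theorem contractNth_last_last {n : ℕ} (a : Fin (n + 2) → A) :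
    Fin.contractNth (Fin.last n).castSucc (· * ·) a (Fin.last n)
      = Fin.init a (Fin.last n) * a (Fin.last (n + 1)) := by
  simp [Fin.init, Fin.contractNth]

/-- Appending a variable that acts on the right turns all faces of the differential but the last
into faces of the longer function. -/
theorem actLast_barD {n : ℕ} (F : (Fin n → A) → M) (a : Fin (n + 2) → A) :
    actLast k (barD k F) a = biTens k (a 0) 1 • actLast k F (Fin.tail a)
      + ∑ j : Fin (n + 1), actLast k F (Fin.contractNth j.castSucc (· * ·) a) := by
  rw [Fin.sum_univ_castSucc]
  simp only [actLast, barD, smul_add, Finset.smul_sum, biTens_smul, init_contractNth_castSucc,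
    contractNth_castSucc_last, init_contractNth_last, contractNth_last_last, one_mul, mul_one,
    Fin.tail_init_eq_init_tail, ← add_assoc]
  rfl

end Plain

variable [AddCommGroup M] [Module k M] [Module (A ⊗[k] Aᵐᵒᵖ) M]
  [IsScalarTower k (A ⊗[k] Aᵐᵒᵖ) M]

/-- `actLast` of a multilinear map, as a multilinear map. -/
def multiActLast {n : ℕ} (f : MultilinearMap k (fun _ : Fin n => A) M) :
    MultilinearMap k (fun _ : Fin (n + 1) => A) M where
  toFun := actLast k f
  map_update_add' := by
    intro inst a l u v
    obtain rfl := Subsingleton.elim inst (instDecidableEqFin _)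
    refine Fin.lastCases ?_ (fun i => ?_) l
    · simp [actLast, biTens, Fin.init_update_last, TensorProduct.tmul_add, add_smul]
    · simp [actLast, Fin.init_update_castSucc,
        Function.update_of_ne (Fin.castSucc_lt_last i).ne']
  map_update_smul' := by
    intro inst a l c v
    obtain rfl := Subsingleton.elim inst (instDecidableEqFin _)
    refine Fin.lastCases ?_ (fun i => ?_) l
    · simp [actLast, biTens, Fin.init_update_last]
    · simp [actLast, Fin.init_update_castSucc,
        Function.update_of_ne (Fin.castSucc_lt_last i).ne', smul_comm _ c]

@[simp]
theorem coe_multiActLast {n : ℕ} (f : MultilinearMap k (fun _ : Fin n => A) M) :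
    ⇑(multiActLast k f) = actLast k f := rfl

/-- The extension of a `k`-linear map `τ : A → M` to the map `A ⊗ Aᵒᵖ → M`, `a ⊗ b ↦ a τ(b)`. -/
noncomputable def leftExt (τ : A →ₗ[k] M) : A ⊗[k] Aᵐᵒᵖ →ₗ[k] M :=
  TensorProduct.lift <| LinearMap.mk₂ k (fun a b => biTens k a 1 • τ (unop b))
    (by intros; simp [biTens, TensorProduct.add_tmul, add_smul])
    (by intros; simp [biTens, ← TensorProduct.smul_tmul'])
    (by intros; simp)
    (fun c a b => by rw [unop_smul, map_smul, smul_comm])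

@[simp]
theorem leftExt_biTens (τ : A →ₗ[k] M) (a b : A) :
    leftExt k τ (biTens k a b) = biTens k a 1 • τ b := by
  simp [leftExt, biTens]

theorem leftExt_mul (τ : A →ₗ[k] M) (a : A) (z : A ⊗[k] Aᵐᵒᵖ) :
    leftExt k τ (biTens k a 1 * z) = biTens k a 1 • leftExt k τ z := by
  induction z with
  | zero => simp
  | tmul u v =>
    change leftExt k τ (biTens k a 1 * biTens k u (unop v)) = _ • leftExt k τ (biTens k u (unop v))
    simp [biTens_mul, biTens_smul]
  | add z w hz hw => rw [mul_add, map_add, hz, hw, map_add, smul_add]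

end Bar

section Lift

variable (k : Type*) {A : Type*} [CommRing k] [Ring A] [Algebra k A]
  {M : ℕ → Type*} [∀ n, AddCommGroup (M n)] [∀ n, Module k (M n)]
  [∀ n, Module (A ⊗[k] Aᵐᵒᵖ) (M n)] [∀ n, IsScalarTower k (A ⊗[k] Aᵐᵒᵖ) (M n)]

/-- The map from the bar resolution determined by an augmentation generator `η` and a family `t`
of left-linear maps: `Ψₙ(a₁, …, aₙ) = t(Ψₙ₋₁(a₁, …, aₙ₋₁) aₙ)`. -/
def barLift (t : ∀ n, M n →ₗ[k] M (n + 1)) (η : M 0) :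
    (n : ℕ) → MultilinearMap k (fun _ : Fin n => A) (M n)
  | 0 => MultilinearMap.constOfIsEmpty k _ η
  | n + 1 => (t n).compMultilinearMap (multiActLast k (barLift t η n))

/-- The homotopy between an arbitrary chain map `Ψ` and `barLift t η`, given by
`sₙ(a₁, …, aₙ) = t(Ψₙ(a₁, …, aₙ) + sₙ₋₁(a₁, …, aₙ₋₁) aₙ)`. -/
def barHomotopy (t : ∀ n, M n →ₗ[k] M (n + 1))
    (Ψ : ∀ n, MultilinearMap k (fun _ : Fin n => A) (M n)) :
    (n : ℕ) → MultilinearMap k (fun _ : Fin n => A) (M (n + 1))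
  | 0 => (t 0).compMultilinearMap (Ψ 0)
  | n + 1 => (t (n + 1)).compMultilinearMap (Ψ (n + 1) + multiActLast k (barHomotopy t Ψ n))

theorem barLift_succ_apply (t : ∀ n, M n →ₗ[k] M (n + 1)) (η : M 0) (n : ℕ)
    (a : Fin (n + 1) → A) :
    barLift k t η (n + 1) a = t n (actLast k (barLift k t η n) a) := rfl

theorem add_self_of_charP_two (k : Type*) {M : Type*} [CommRing k] [CharP k 2] [AddCommGroup M]
    [Module k M] (m : M) : m + m = 0 := by
  rw [← two_smul k m, CharTwo.two_eq_zero, zero_smul]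

/-- A left-linear contraction turns `barLift` into a chain map. For `z = Ψₙ(a₁, …, aₙ) aₙ₊₁` the
identity `z = Dtz + tDz` expresses `DΨₙ₊₁(a₁, …, aₙ₊₁) = Dtz` as the sum of the last face `z` and of
`tDz`, which by induction consists of the remaining faces. -/
theorem diff_barLift [CharP k 2] (D : ∀ n, M (n + 1) →ₗ[A ⊗[k] Aᵐᵒᵖ] M n)
    (t : ∀ n, M n →ₗ[k] M (n + 1)) (η : M 0)
    (ht : ∀ n (a : A) m, t n (biTens k a 1 • m) = biTens k a 1 • t n m)
    (h0 : ∀ a : A, D 0 (t 0 (biTens k 1 a • η)) = biTens k 1 a • η + biTens k a 1 • η)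
    (h : ∀ n m, D (n + 1) (t (n + 1) m) + t n (D n m) = m) (n : ℕ) (a : Fin (n + 1) → A) :
    D n (barLift k t η (n + 1) a) = barD k (barLift k t η n) a := by
  induction n with
  | zero =>
    have := h0 (a 0)
    simpa [barLift, barD, actLast, add_comm] using this
  | succ n ih =>
    have h1 := h n (actLast k (barLift k t η (n + 1)) a)
    have h2 : D n (actLast k (barLift k t η (n + 1)) a)
        = actLast k (barD k (barLift k t η n)) a := by
      simp only [actLast, map_smul, ih]
    rw [h2, actLast_barD, map_add, map_sum, ht] at h1
    rw [barLift_succ_apply k t η (n + 1), barD]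
    simp only [barLift_succ_apply k t η n] at h1 ⊢
    linear_combination (norm := abel) h1
      - add_self_of_charP_two k (biTens k (a 0) 1 • t n (actLast k (barLift k t η n) (Fin.tail a))
        + ∑ j : Fin (n + 1),
          t n (actLast k (barLift k t η n) (Fin.contractNth j.castSucc (· * ·) a)))

/-- Two chain maps from the bar resolution that lift the same augmentation are homotopic. -/
theorem diff_barHomotopy [CharP k 2] (D : ∀ n, M (n + 1) →ₗ[A ⊗[k] Aᵐᵒᵖ] M n)
    (t : ∀ n, M n →ₗ[k] M (n + 1)) (η : M 0)
    (ht : ∀ n (a : A) m, t n (biTens k a 1 • m) = biTens k a 1 • t n m)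
    (h : ∀ n m, D (n + 1) (t (n + 1) m) + t n (D n m) = m)
    (Ψ : ∀ n, MultilinearMap k (fun _ : Fin n => A) (M n))
    (hΨ : ∀ n a, D n (Ψ (n + 1) a) = barD k (Ψ n) a)
    (hΨ0 : ∀ a, D 0 (t 0 (Ψ 0 a)) = Ψ 0 a + η) (n : ℕ) (a : Fin (n + 1) → A) :
    D (n + 1) (barHomotopy k t Ψ (n + 1) a) + barD k (barHomotopy k t Ψ n) a
      = Ψ (n + 1) a + barLift k t η (n + 1) a := by
  have h2 : ∀ {n} (m : M n), m + m = 0 := add_self_of_charP_two k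
  induction n with
  | zero =>
    have h1 := h 0 (Ψ 1 a + actLast k (barHomotopy k t Ψ 0) a)
    have h3 : D 0 (actLast k (barHomotopy k t Ψ 0) a)
        = actLast k (Ψ 0) a + actLast k (fun _ => η) a := by
      simp only [actLast, map_smul, ← smul_add]
      exact congrArg _ (hΨ0 _)
    have h4 : barLift k t η 1 a = t 0 (actLast k (fun _ => η) a) := rfl
    have h5 : biTens k (a 0) 1 • barHomotopy k t Ψ 0 (Fin.tail a)
        = t 0 (biTens k (a 0) 1 • Ψ 0 (Fin.tail a)) := (ht 0 _ _).symm
    have h6 : barHomotopy k t Ψ 1 a = t 1 (Ψ 1 a + actLast k (barHomotopy k t Ψ 0) a) := rfl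
    rw [map_add (D 0), h3, hΨ] at h1
    simp only [barD, Finset.univ_eq_empty, Finset.sum_empty, add_zero, map_add] at h1 ⊢
    rw [h4, h5, h6]
    simp only [map_add]
    linear_combination (norm := abel) h1
      + h2 (actLast k (barHomotopy k t Ψ 0) a)
      - h2 (t 0 (actLast k (fun _ => η) a)) - h2 (t 0 (actLast k (Ψ 0) a))
  | succ n ih =>
    set s := barHomotopy k t Ψ with hs
    have h1 := h (n + 1) (Ψ (n + 2) a + actLast k (s (n + 1)) a)
    have h3 : D (n + 1) (actLast k (s (n + 1)) a) + actLast k (barD k (s n)) a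
        = actLast k (Ψ (n + 1)) a + actLast k (barLift k t η (n + 1)) a := by
      simp only [actLast, map_smul, ← smul_add, ih]
    rw [actLast_barD] at h3
    have h3 := congrArg (t (n + 1)) h3
    have h6 : ∀ (n) (a : Fin (n + 1) → A), s (n + 1) a
      = t (n + 1) (Ψ (n + 1) a + actLast k (s n) a) := fun _ _ => rfl
    rw [map_add (D _), hΨ] at h1
    rw [h6 (n + 1), barD, barLift_succ_apply]
    simp only [h6 n, barD, map_add, map_sum, ht, smul_add, Finset.sum_add_distrib] at h1 h3 ⊢
    linear_combination (norm := abel) h1 + h3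
      + h2 (actLast k (s (n + 1)) a)
      - h2 (t (n + 1) (D (n + 1) (actLast k (s (n + 1)) a)))

end Lift

/-! ### A left-linear contraction of the resolution -/

namespace R20

/-- The coefficients of a left-linear contraction of the resolution: the entry with indices
`j`, `l` lists the `l`-th components of the images of `1 ⊗ w` in the `j`-th summand, for the eight
words `w` in the order of `shortWord`. In degree zero it is the derivative `w ↦ ∑ u ⊗ v` over the
factorizations `w = uxv`, respectively `w = uyv`. -/
def contrCoef (K : Type*) [Field K] (d : K) :
    (n : ℕ) → Fin (rk n) → Fin (rk (n + 1)) → Fin 8 → Env K (R20 K d)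
  | 0 =>
    let x := x K d
    let y := y K d
    (![
    ![
      ![
        0, tens 1 1, 0, tens 1 y, tens y 1, tens 1 (y * x) + tens (x * y) 1, tens y y,
        tens 1 (y * (x * y)) + tens (x * y) y],
      ![
        0, 0, tens 1 1, tens x 1, tens 1 x, tens x x, tens 1 (x * y) + tens (y * x) 1,
        tens x (x * y) + tens (x * (y * x)) 1]]] : Fin 1 → Fin 2 → Fin 8 → Env K (R20 K d))
  | 1 =>
    let x := x K d
    let y := y K d
    (![
    ![
      ![
        0, tens 1 1, 0, tens 1 y + tens y (y * x) + d • tens y (y * (x * y)), 0,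
        tens 1 (y * x) + d • tens y (x * (y * (x * y))), 0, tens 1 (y * (x * y))],
      ![
        0, 0, 0, tens (y * x) 1, 0, tens (y * x) x, 0, tens (y * x) (x * y)]],
    ![
      ![
        0, 0, 0, 0,
        d • tens 1 (y * (x * y)) + d • tens x x + tens (x * y) 1 + d • tens (y * (x * y)) 1
          + tens (y * (x * y)) x + tens (x * (y * (x * y))) 1,
        tens 1 x + tens x 1, tens x x + tens (x * y) y + tens (y * (x * y)) 1,
        tens y x + tens (x * y) (y * x) + tens (y * x) 1],
      ![
        0, 0, tens 1 1, 0,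
        tens 1 x + tens x (x * y) + d • tens (y * x) (x * y) + tens (y * (x * y)) y, 0,
        tens 1 (x * y) + tens x y + tens (x * y) 1,
        tens 1 (x * (y * x)) + d • tens (x * y) (y * x)]]]
      : Fin 2 → Fin 2 → Fin 8 → Env K (R20 K d))
  | 2 =>
    let x := x K d
    let y := y K d
    (![
    ![
      ![
        0, 0,
        d • tens (x * y) (x * (y * (x * y))) + d ^ 2 • tens (x * (y * (x * y))) (y * (x * y)),
        tens 1 y + tens y 1 + d • tens (x * y) x + d • tens (x * (y * x)) 1,
        d • tens y (y * (x * y)) + d • tens (x * (y * x)) (x * y),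
        tens 1 (y * x) + tens y x + d • tens (x * y) (y * (x * y)) + d • tens (x * (y * x)) x, 0,
        tens 1 (y * (x * y)) + tens y (x * y) + tens (y * x) y + d • tens (x * (y * x)) (x * y)
          + tens (y * (x * y)) 1]],
    ![
      ![
        0, 0, tens 1 1 + d • tens y 1 + d ^ 2 • tens (x * y) x + d ^ 2 • tens (x * (y * x)) 1,
        tens x 1 + d • tens (x * y) 1, tens 1 x + d • tens y x + d ^ 2 • tens (x * (y * x)) x,
        d • tens (x * y) x,
        tens 1 (x * y) + tens x y + d • tens y (x * y) + tens (x * y) 1 + tens (y * x) 1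
          + d • tens (y * x) y + d ^ 2 • tens (x * (y * x)) (x * y),
        tens 1 (x * (y * x)) + tens x (y * x) + d • tens y (x * (y * x)) + tens (x * y) x
          + d • tens (y * x) (y * x) + d ^ 2 • tens (x * (y * x)) (x * (y * x))]]]
      : Fin 2 → Fin 1 → Fin 8 → Env K (R20 K d))
  | 3 =>
    (![
    ![
      ![
        0, 0, 0, 0, 0, 0, 0, tens 1 1]]] : Fin 1 → Fin 1 → Fin 8 → Env K (R20 K d))
  | n + 4 => contrCoef K d n

variable {K : Type*} [Field K] [CharP K 2] {d : K}

/-- The left-linear endomorphism of `R ⊗ Rᵒᵖ` that takes the values `g` at `1 ⊗ w` for the eight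
words `w`. -/
noncomputable def wordExt (g : Fin 8 → Env K (R20 K d)) :
    Env K (R20 K d) →ₗ[K] Env K (R20 K d) :=
  leftExt K ((wordBasis K d).constr K g)

theorem wordExt_biTens (g : Fin 8 → Env K (R20 K d)) (a : R20 K d) (i : Fin 8) :
    wordExt g (biTens K a (shortWord (x K d) (y K d) i)) = biTens K a 1 * g i := by
  rw [wordExt, leftExt_biTens, ← wordBasis_apply, Module.Basis.constr_basis, smul_eq_mul]

theorem wordExt_mul (g : Fin 8 → Env K (R20 K d)) (a : R20 K d) (z : Env K (R20 K d)) :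
    wordExt g (biTens K a 1 * z) = biTens K a 1 * wordExt g z :=
  leftExt_mul K _ a z

/-- The left-linear contraction of the resolution with coefficients `contrCoef`. -/
noncomputable def contr (K : Type*) [Field K] [CharP K 2] (d : K) (n : ℕ) :
    P K d n →ₗ[K] P K d (n + 1) :=
  LinearMap.pi fun l => ∑ j, wordExt (contrCoef K d n j l) ∘ₗ LinearMap.proj j

theorem contr_apply (n : ℕ) (z : P K d n) (l : Fin (rk (n + 1))) :
    contr K d n z l = ∑ j, wordExt (contrCoef K d n j l) (z j) := by
  simp [contr]

theorem contr_smul (n : ℕ) (a : R20 K d) (z : P K d n) :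
    contr K d n (biTens K a 1 • z) = biTens K a 1 • contr K d n z := by
  funext l
  simp only [contr_apply, Pi.smul_apply, smul_eq_mul, wordExt_mul, Finset.mul_sum]

theorem contr_single (n : ℕ) (j : Fin (rk n)) (i : Fin 8) (l : Fin (rk (n + 1))) :
    contr K d n (Pi.single j (biTens K 1 (shortWord (x K d) (y K d) i))) l
      = contrCoef K d n j l i := by
  rw [contr_apply, Finset.sum_eq_single j (fun l _ h => by simp [Pi.single_eq_of_ne h])
    (fun h => absurd (Finset.mem_univ j) h), Pi.single_eq_same, wordExt_biTens, biTens_one,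
    one_mul]

/-- Left-linear maps out of a term of the resolution are determined by their values on `1 ⊗ w` for
the eight words `w`. -/
theorem ext_of_leftLinear {n : ℕ} {M : Type*} [AddCommGroup M] [Module K M]
    [Module (Env K (R20 K d)) M] (f g : P K d n →ₗ[K] M)
    (hf : ∀ (a : R20 K d) z, f (biTens K a 1 • z) = biTens K a 1 • f z)
    (hg : ∀ (a : R20 K d) z, g (biTens K a 1 • z) = biTens K a 1 • g z)
    (h : ∀ j i, f (Pi.single j (biTens K 1 (shortWord (x K d) (y K d) i)))
      = g (Pi.single j (biTens K 1 (shortWord (x K d) (y K d) i)))) : f = g := by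
  refine LinearMap.pi_ext' fun j => TensorProduct.ext' fun a b => ?_
  have h1 : f ∘ₗ LinearMap.single K (fun _ => Env K (R20 K d)) j ∘ₗ
        TensorProduct.mk K _ _ 1 ∘ₗ (opLinearEquiv K).toLinearMap =
      g ∘ₗ LinearMap.single K (fun _ => Env K (R20 K d)) j ∘ₗ
        TensorProduct.mk K _ _ 1 ∘ₗ (opLinearEquiv K).toLinearMap :=
    (wordBasis K d).ext fun i => by
      rw [wordBasis_apply]
      exact h j i
  have h3 := LinearMap.congr_fun h1 (unop b)
  have h4 : Pi.single (M := fun _ => Env K (R20 K d)) j (a ⊗ₜ[K] b)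
      = biTens K a 1 • Pi.single j (biTens K 1 (unop b)) := by
    funext l
    obtain rfl | hl := eq_or_ne l j
    · simp [biTens]
    · simp [Pi.single_eq_of_ne hl]
  change f (Pi.single j (a ⊗ₜ[K] b)) = g (Pi.single j (a ⊗ₜ[K] b))
  rw [h4, hf, hg]
  exact congrArg _ h3

end R20

/-! ### The contraction identities on words -/

section Tens

variable (k : Type*) {A : Type*} [CommRing k] [Ring A] [Algebra k A]

theorem biTens_add_left (a a' b : A) :
    biTens k (a + a') b = biTens k a b + biTens k a' b := TensorProduct.add_tmul ..

theorem biTens_add_right (a b b' : A) :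
    biTens k a (b + b') = biTens k a b + biTens k a b' := TensorProduct.tmul_add ..

theorem biTens_smul_left (c : k) (a b : A) : biTens k (c • a) b = c • biTens k a b := rfl

theorem biTens_smul_right (c : k) (a b : A) : biTens k a (c • b) = c • biTens k a b :=
  TensorProduct.tmul_smul c a (op b)

theorem biTens_zero_left (b : A) : biTens k 0 b = 0 := TensorProduct.zero_tmul ..

theorem biTens_zero_right (a : A) : biTens k a 0 = 0 := TensorProduct.tmul_zero ..

theorem smul_mul_env (c : k) (u v : A ⊗[k] Aᵐᵒᵖ) : (c • u) * v = c • (u * v) :=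
  smul_mul_assoc c u v

theorem mul_smul_env (c : k) (u v : A ⊗[k] Aᵐᵒᵖ) : u * (c • v) = c • (u * v) :=
  mul_smul_comm c u v

/-- Two vectors are equal if their multiples by `1` are; this makes the scalars visible. -/
theorem eq_of_one_smul (k : Type*) {M : Type*} [CommRing k] [AddCommGroup M] [Module k M]
    {u v : M} (h : (1 : k) • u = (1 : k) • v) : u = v := by
  simpa using h

end Tens

namespace R20

variable {K : Type*} [Field K] {d : K}

theorem diff_apply (n : ℕ) (z : P K d (n + 1)) (i : Fin (rk n)) :
    diff K d n z i = ∑ j, z j * dMat K d n j i := rfl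

theorem diff_single (n : ℕ) (j : Fin (rk (n + 1))) (z : Env K (R20 K d)) (i : Fin (rk n)) :
    diff K d n (Pi.single j z) i = z * dMat K d n j i := by
  rw [diff_apply, Finset.sum_eq_single j (fun l _ h => by simp [Pi.single_eq_of_ne h])
    (fun h => absurd (Finset.mem_univ j) h), Pi.single_eq_same]

theorem tens_eq (a b : R20 K d) : tens a b = biTens K a b := rfl

section Words

variable [CharP K 2] (g : Fin 8 → Env K (R20 K d)) (a : R20 K d)

theorem wordExt_one : wordExt g (biTens K a 1) = biTens K a 1 * g 0 := wordExt_biTens g a 0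
theorem wordExt_x : wordExt g (biTens K a (x K d)) = biTens K a 1 * g 1 := wordExt_biTens g a 1
theorem wordExt_y : wordExt g (biTens K a (y K d)) = biTens K a 1 * g 2 := wordExt_biTens g a 2
theorem wordExt_xy : wordExt g (biTens K a (x K d * y K d)) = biTens K a 1 * g 3 :=
  wordExt_biTens g a 3
theorem wordExt_yx : wordExt g (biTens K a (y K d * x K d)) = biTens K a 1 * g 4 :=
  wordExt_biTens g a 4
theorem wordExt_xyx : wordExt g (biTens K a (x K d * (y K d * x K d))) = biTens K a 1 * g 5 :=
  wordExt_biTens g a 5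
theorem wordExt_yxy : wordExt g (biTens K a (y K d * (x K d * y K d))) = biTens K a 1 * g 6 :=
  wordExt_biTens g a 6
theorem wordExt_xyxy :
    wordExt g (biTens K a (x K d * (y K d * (x K d * y K d)))) = biTens K a 1 * g 7 :=
  wordExt_biTens g a 7

end Words

variable [CharP K 2]

section Homotopy

-- The rules for words rewrite every product to a combination of elements `u ⊗ v` with `u`, `v`
-- among the eight words; comparing coefficients then proves the identities.
attribute [local simp] shortWord tens_eq mul_add add_mul biTens_mul mul_assoc
  xx xxy xxyx xxyxy yy yyx yyxy yxyx yxyxy biTens_add_left biTens_add_right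
  biTens_smul_left biTens_smul_right biTens_zero_left biTens_zero_right
  smul_mul_env mul_smul_env smul_smul wordExt_one wordExt_x wordExt_y wordExt_xy wordExt_yx
  wordExt_xyx wordExt_yxy wordExt_xyxy

set_option maxHeartbeats 1600000 in
/-- The identity `dt = 1 + sμ` in degree zero on the elements `1 ⊗ w`, where `s(a) = a ⊗ 1`. -/
theorem contraction_zero (j : Fin 1) (i : Fin 8) (l : Fin 1) :
    ∑ m : Fin 2, contrCoef K d 0 j m i * dMat K d 0 m l
      = biTens K 1 (shortWord (x K d) (y K d) i) + biTens K (shortWord (x K d) (y K d) i) 1 := by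
  fin_cases j
  fin_cases i <;> fin_cases l <;> simp [contrCoef, dMat] <;>
    apply eq_of_one_smul K <;> match_scalars <;>
    first | exact CharTwo.add_self_eq_zero _ | grind

set_option maxHeartbeats 1600000 in
/-- The identity `dt + td = 1` on the elements `1 ⊗ w` of `P₁`; the following lemmas treat `P₂`,
`P₃` and `P₄`, which is all that is needed by periodicity. -/
theorem contraction_one (j : Fin 2) (i : Fin 8) (l : Fin 2) :
    ∑ m : Fin 2, contrCoef K d 1 j m i * dMat K d 1 m l
      + ∑ m : Fin 1, wordExt (contrCoef K d 0 m l)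
          (biTens K 1 (shortWord (x K d) (y K d) i) * dMat K d 0 j m)
      = if l = j then biTens K 1 (shortWord (x K d) (y K d) i) else 0 := by
  fin_cases j <;> fin_cases i <;> fin_cases l <;> simp [dMat] <;> simp [contrCoef] <;>
    apply eq_of_one_smul K <;> match_scalars <;> first | exact CharTwo.add_self_eq_zero _ | grind

set_option maxHeartbeats 1600000 in
theorem contraction_two (j : Fin 2) (i : Fin 8) (l : Fin 2) :
    ∑ m : Fin 1, contrCoef K d 2 j m i * dMat K d 2 m l
      + ∑ m : Fin 2, wordExt (contrCoef K d 1 m l)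
          (biTens K 1 (shortWord (x K d) (y K d) i) * dMat K d 1 j m)
      = if l = j then biTens K 1 (shortWord (x K d) (y K d) i) else 0 := by
  fin_cases j <;> fin_cases i <;> fin_cases l <;> simp [dMat] <;> simp [contrCoef] <;>
    apply eq_of_one_smul K <;> match_scalars <;> first | exact CharTwo.add_self_eq_zero _ | grind

set_option maxHeartbeats 1600000 in
theorem contraction_three (j : Fin 1) (i : Fin 8) (l : Fin 1) :
    ∑ m : Fin 1, contrCoef K d 3 j m i * dMat K d 3 m l
      + ∑ m : Fin 2, wordExt (contrCoef K d 2 m l)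
          (biTens K 1 (shortWord (x K d) (y K d) i) * dMat K d 2 j m)
      = if l = j then biTens K 1 (shortWord (x K d) (y K d) i) else 0 := by
  fin_cases j
  fin_cases i <;> fin_cases l <;> simp [dMat] <;> simp [contrCoef] <;>
    apply eq_of_one_smul K <;> match_scalars <;>
    first | exact CharTwo.add_self_eq_zero _ | grind

set_option maxHeartbeats 1600000 in
theorem contraction_four (j : Fin 1) (i : Fin 8) (l : Fin 1) :
    ∑ m : Fin 2, contrCoef K d 4 j m i * dMat K d 4 m l
      + ∑ m : Fin 1, wordExt (contrCoef K d 3 m l)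
          (biTens K 1 (shortWord (x K d) (y K d) i) * dMat K d 3 j m)
      = if l = j then biTens K 1 (shortWord (x K d) (y K d) i) else 0 := by
  fin_cases j
  fin_cases i <;> fin_cases l <;> simp [dMat] <;> simp [contrCoef] <;>
    apply eq_of_one_smul K <;> match_scalars <;>
    first | exact CharTwo.add_self_eq_zero _ | grind

end Homotopy

end R20

/-! ### Comparison morphisms and independence of their choice -/

theorem hochschildD_eq_barD {K A M : Type*} [Field K] [CharP K 2] [Ring A] [Algebra K A]
    [AddCommGroup M] [Module K M] [Module (Env K A) M] [IsScalarTower K (Env K A) M] {n : ℕ}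
    (f : Cochain K A M n) (a : Fin (n + 1) → A) :
    hochschildD K A M n f a = barD K f a := by
  rw [hochschildD_apply, barD, actLast]
  have h : (-1 : K) = 1 := CharTwo.neg_eq 1
  simp only [h, one_pow, one_smul, biTens]

namespace R20

variable {K : Type*} [Field K] {d : K}

theorem env_smul_add {n : ℕ} (u : Env K (R20 K d)) (z w : P K d n) :
    u • (z + w) = u • z + u • w := smul_add u z w

theorem env_mul_smul {n : ℕ} (u v : Env K (R20 K d)) (z : P K d n) :
    (u * v) • z = u • v • z := mul_smul u v z

/-- The generator `1 ⊗ 1` of `P₀`. -/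
noncomputable def gen (K : Type*) [Field K] (d : K) : P K d 0 := fun _ => biTens K 1 1

theorem gen_apply (i : Fin (rk 0)) : gen K d i = biTens K 1 1 := rfl

theorem biTens_smul_self (a b r : R20 K d) : biTens K a b • r = a * r * b := env_tmul_smul a b r

theorem aug_apply (z : P K d 0) (i : Fin (rk 0)) : aug K d z = z i • (1 : R20 K d) := by
  obtain rfl : (0 : Fin 1) = i := Subsingleton.elim (α := Fin 1) _ _
  exact Fin.sum_univ_one (fun i : Fin 1 => z i • (1 : R20 K d))

theorem aug_gen : aug K d (gen K d) = 1 := by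
  rw [aug_apply _ (⟨0, Nat.zero_lt_succ 0⟩ : Fin (rk 0)), gen_apply, biTens_smul_self,
    one_mul, one_mul]

theorem Comparison.pull_apply (Ψ : Comparison K d) {n : ℕ}
    (c : P K d n →ₗ[Env K (R20 K d)] R20 K d) (a : Fin n → R20 K d) :
    Ψ.pull c a = c (Ψ.toFun n a) := rfl

variable [CharP K 2]

theorem contr_diff_single (n : ℕ) (j : Fin (rk (n + 1))) (z : Env K (R20 K d))
    (l : Fin (rk (n + 1))) :
    contr K d n (diff K d n (Pi.single j z)) l
      = ∑ m, wordExt (contrCoef K d n m l) (z * dMat K d n j m) := by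
  simp only [contr_apply, diff_single]

theorem diff_contr_single (n : ℕ) (j : Fin (rk n)) (i : Fin 8) (l : Fin (rk n)) :
    diff K d n (contr K d n (Pi.single j (biTens K 1 (shortWord (x K d) (y K d) i)))) l
      = ∑ m, contrCoef K d n j m i * dMat K d n m l := by
  simp only [diff_apply, contr_single]

theorem homotopy_coef : (n : ℕ) → (j : Fin (rk (n + 1))) → (i : Fin 8) →
    (l : Fin (rk (n + 1))) →
    ∑ m, contrCoef K d (n + 1) j m i * dMat K d (n + 1) m l
      + ∑ m, wordExt (contrCoef K d n m l)
          (biTens K 1 (shortWord (x K d) (y K d) i) * dMat K d n j m)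
      = if l = j then biTens K 1 (shortWord (x K d) (y K d) i) else 0
  | 0, j, i, l => contraction_one j i l
  | 1, j, i, l => contraction_two j i l
  | 2, j, i, l => contraction_three j i l
  | 3, j, i, l => contraction_four j i l
  | n + 4, j, i, l => homotopy_coef n j i l

/-- The maps `contr` form a contracting homotopy in positive degrees. -/
theorem diff_contr (n : ℕ) (z : P K d (n + 1)) :
    diff K d (n + 1) (contr K d (n + 1) z) + contr K d n (diff K d n z) = z := by
  have h : ((diff K d (n + 1)).restrictScalars K ∘ₗ contr K d (n + 1)
      + contr K d n ∘ₗ (diff K d n).restrictScalars K) = LinearMap.id :=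
    ext_of_leftLinear _ _
      (fun a z => by simpa [contr_smul] using (env_smul_add _ _ _).symm) (fun a z => rfl)
      fun j i => by
      funext l
      simp only [LinearMap.add_apply, LinearMap.comp_apply, LinearMap.coe_restrictScalars,
        LinearMap.id_apply, Pi.add_apply, contr_diff_single, diff_contr_single, homotopy_coef,
        Pi.single_apply]
  exact LinearMap.congr_fun h z

/-- In degree zero, `contr` contracts onto the image of the augmentation. -/
theorem diff_contr_zero (z : P K d 0) :
    diff K d 0 (contr K d 0 z) = z + biTens K (aug K d z) 1 • gen K d := by
  let g : P K d 0 →ₗ[K] P K d 0 := LinearMap.id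
    + LinearMap.pi (fun _ => (TensorProduct.mk K (R20 K d) _).flip (op 1)
      ∘ₗ (aug K d).restrictScalars K)
  have hg : ∀ z, g z = z + biTens K (aug K d z) 1 • gen K d := fun z => by
    funext l
    simp [g, gen, biTens]
  have h : ((diff K d 0).restrictScalars K ∘ₗ contr K d 0) = g :=
    ext_of_leftLinear _ _ (fun a z => by simp [contr_smul])
      (fun a z => by
        have h : biTens K (biTens K a 1 • aug K d z) (1 : R20 K d)
            = biTens K a 1 * biTens K (aug K d z) 1 := by
          rw [biTens_mul, mul_one, biTens_smul_self, mul_one]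
        rw [hg, hg, map_smul, h, env_mul_smul, env_smul_add])
      fun j i => by
        funext l
        refine (diff_contr_single 0 j i l).trans ((contraction_zero j i l).trans ?_)
        have hj : ∀ m : Fin (rk 0), j = m := Subsingleton.elim (α := Fin 1) j
        have h : aug K d (Pi.single j (biTens K 1 (shortWord (x K d) (y K d) i)))
            = shortWord (x K d) (y K d) i := by
          rw [aug_apply _ j, Pi.single_eq_same, biTens_smul_self, one_mul, one_mul]
        rw [hg, h, Pi.add_apply, ← hj l, Pi.single_eq_same, Pi.smul_apply, gen_apply, smul_eq_mul,
          biTens_mul, mul_one, mul_one]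
  rw [← hg, ← h]
  rfl

/-- The comparison morphism determined by the contraction `contr`. -/
noncomputable def stdComparison (K : Type*) [Field K] [CharP K 2] (d : K) : Comparison K d where
  toFun := barLift K (contr K d) (gen K d)
  aug_zero _ := aug_gen
  comm n a := by
    rw [hochschildD_eq_barD]
    refine diff_barLift K (diff K d) (contr K d) (gen K d) contr_smul (fun a => ?_) diff_contr n a
    rw [diff_contr_zero, map_smul, aug_gen, biTens_smul_self, one_mul, one_mul]

/-- The class of a cocycle of `Hom(P, R)` does not depend on the comparison morphism. -/
theorem Comparison.toHH_eq (Ψ : Comparison K d) {n : ℕ} (c : CocycleP K d (n + 1)) :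
    Ψ.toHH c = (stdComparison K d).toHH c := by
  refine (Submodule.Quotient.eq _).2 (Submodule.mem_comap.2 ?_)
  let s := barHomotopy K (contr K d) Ψ.toFun
  refine ⟨(c.1.restrictScalars K).compMultilinearMap (s n), MultilinearMap.ext fun a => ?_⟩
  have h := diff_barHomotopy K (diff K d) (contr K d) (gen K d) contr_smul diff_contr Ψ.toFun
    (fun n a => by rw [Ψ.comm, hochschildD_eq_barD])
    (fun a => by rw [diff_contr_zero, Ψ.aug_zero]; exact congrArg _ (one_smul _ _)) n a
  have h1 := congrArg c.1 h
  have h2 : ∀ z, c.1 (diff K d (n + 1) z) = 0 := LinearMap.congr_fun c.2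
  rw [map_add, h2, zero_add, map_add] at h1
  have h3 : barD K (fun a => c.1 (s n a)) a = c.1 (barD K (s n) a) := by
    simp only [barD, actLast, map_add, map_sum, map_smul]
  rw [hochschildD_eq_barD]
  refine h3.trans (h1.trans ?_)
  change _ = Ψ.pull c.1 a - (stdComparison K d).pull c.1 a
  rw [Comparison.pull_apply, Comparison.pull_apply, sub_eq_add_neg]
  exact congrArg _ (eq_neg_of_add_eq_zero_left (add_self_of_charP_two K _))

end R20

/-! ### Deformed relations and the deformed differentials -/

/-- The relations of the first-order deformation of `R(2, 0, d)` with parameters `a₁`, `a₂`, `a₃`: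
left multiplication by `x` and by `y` on the eight words, where the product is not again a word.
The parameters enter through `x² = yxy + a₁x + a₃y` and
`y² = xyx + d(xy)² + a₂y + a₃(x + dxy)`; the other relations describe the products that involve
longer words. -/
structure DeformedRelations {k A : Type*} [CommRing k] [Ring A] [Algebra k A] (x y : A)
    (d a₁ a₂ a₃ : k) : Prop where
  xx : x * x = y * (x * y) + a₁ • x + a₃ • y
  xxy : x * (x * y) = a₁ • (x * y) + (a₁ + a₃ * d) • (x * (y * (x * y))) + a₂ • (y * (x * y))
    + a₃ • (x * (y * x))
  xxyx : x * (x * (y * x)) = a₁ • (x * (y * x)) + a₂ • (x * (y * (x * y)))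
  xxyxy : x * (x * (y * (x * y))) = a₁ • (x * (y * (x * y)))
  yy : y * y = x * (y * x) + d • (x * (y * (x * y))) + a₂ • y + a₃ • x + (a₃ * d) • (x * y)
  yyx : y * (y * x) = a₁ • (x * (y * x)) + (a₁ * d + a₂) • (x * (y * (x * y))) + a₂ • (y * x)
    + a₃ • (y * (x * y))
  yxyx : y * (x * (y * x)) = x * (y * (x * y)) + a₃ • (y * x) + a₃ • (x * y)
  yyxy : y * (y * (x * y)) = a₁ • (x * (y * (x * y))) + a₂ • (y * (x * y))
  yxyxy : y * (x * (y * (x * y))) = a₂ • (x * (y * (x * y))) + a₃ • (y * (x * y))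

open R20 (rk)

/-- The properties of the map `(a, b) ↦ a ⊗ b` from `A × A` to the enveloping algebra. -/
structure IsBitensor (k : Type*) {A B : Type*} [CommRing k] [Ring A] [Algebra k A] [Ring B]
    [Algebra k B] (T : A → A → B) : Prop where
  add_left : ∀ a a' b, T (a + a') b = T a b + T a' b
  add_right : ∀ a b b', T a (b + b') = T a b + T a b'
  smul_left : ∀ (c : k) a b, T (c • a) b = c • T a b
  smul_right : ∀ (c : k) a b, T a (c • b) = c • T a b
  mul : ∀ a b a' b', T a b * T a' b' = T (a * a') (b' * b)

theorem isBitensor_biTens (k A : Type*) [CommRing k] [Ring A] [Algebra k A] :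
    IsBitensor k (biTens k : A → A → A ⊗[k] Aᵐᵒᵖ) :=
  ⟨biTens_add_left k, biTens_add_right k, biTens_smul_left k, biTens_smul_right k, biTens_mul k⟩

/-- Matrices of a deformation of the differentials `R20.dMat` to the algebra with relations
`DeformedRelations`.  The entries lie in an algebra with a map `T` that stands for
`(a, b) ↦ a ⊗ b`. In the second entry of the matrix of index `2`, the factor
`z = (1 + a₂d)(y + dxyx) + a₃dx` is `y(1 + dy)⁻¹` up to second order in the parameters, so that the
entry is `y ⊗ 1 + 1 ⊗ z + d y ⊗ z`. -/
def deformedMat {k A B : Type*} [CommRing k] [Ring A] [Algebra k A] [Ring B] [Algebra k B]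
    (T : A → A → B) (x y : A) (d a₁ a₂ a₃ : k) :
    (n : ℕ) → Matrix (Fin (rk (n + 1))) (Fin (rk n)) B
  | 0 => !![T x 1 + T 1 x;
            T y 1 + T 1 y]
  | 1 => !![T x 1 + T 1 x + T y y + a₁ • T 1 1,
            T 1 (x * y) + T (y * x) 1 + a₃ • T 1 1;
            T 1 (y * x) + T (x * y) 1 + d • T 1 (y * (x * y))
              + d • T (x * y) y + a₃ • (T 1 1 + d • T 1 y),
            T y 1 + T 1 y + T x x + d • T x (x * y)
              + d • T (x * (y * x)) 1 + a₂ • T 1 1 + (a₃ * d) • T x 1]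
  | 2 => !![T x 1 + T 1 x,
            T y 1 + (T 1 1 + d • T y 1)
              * ((1 + a₂ * d) • T 1 (y + d • (x * (y * x))) + (a₃ * d) • T 1 x)]
  | 3 => !![
      T 1 (x * (y * (x * y))) + T x (y * (x * y)) + T y (x * (y * x))
        + T (x * y) (x * y) + T (y * x) (y * x) + T (x * (y * x)) y
        + d • T (x * (y * x)) (x * (y * x)) + T (y * (x * y)) x
        + T (x * (y * (x * y))) 1
        + a₁ • (
          T 1 (y * (x * y)) + T x (x * (y * x))
          + d • T x (x * (y * (x * y))) + T y (x * y) + T y (y * x)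
          + T y (x * (y * (x * y))) + T (x * y) y + T (x * y) (y * (x * y))
          + T (y * x) y + T (y * x) (y * (x * y)) + T (x * (y * x)) x
          + T (x * (y * x)) (x * (y * x)) + T (y * (x * y)) 1
          + T (y * (x * y)) (y * x) + T (y * (x * y)) (x * y)
          + d • T (y * (x * y)) (y * (x * y)) + T (x * (y * (x * y))) y
          + d • T (x * (y * (x * y))) x)
        + a₂ • (
          T 1 (x * (y * x)) + T x (x * y) + T x (y * x)
          + T x (x * (y * (x * y))) + T y (y * (x * y)) + T (x * y) x
          + T (x * y) (x * (y * x)) + T (y * x) x + T (y * x) (x * (y * x))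
          + T (x * (y * x)) 1 + T (x * (y * x)) (y * x)
          + T (x * (y * x)) (x * y) + d • T (x * (y * x)) (y * (x * y))
          + T (y * (x * y)) y + d • T (y * (x * y)) (x * (y * x))
          + T (y * (x * y)) (y * (x * y)) + T (x * (y * (x * y))) x)
        + a₃ • (
          T 1 (x * y) + T x y + d • T x (x * (y * x)) + T y x
          + d • T y (x * (y * (x * y))) + T (x * y) 1 + T (x * y) (y * x)
          + d • T (x * y) (y * (x * y)) + T (y * x) (x * y)
          + d • T (y * x) (y * (x * y)) + d • T (x * (y * x)) x
          + d • T (x * (y * x)) (x * (y * x)) + d • T (y * (x * y)) (y * x)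
          + d • T (y * (x * y)) (x * y) + d • T (x * (y * (x * y))) y)]
  | n + 4 => deformedMat T x y d a₁ a₂ a₃ n

section Complex

variable {k A B : Type*} [CommRing k] [CharP k 2] [Ring A] [Algebra k A] [Ring B] [Algebra k B]
  {T : A → A → B} {x y : A} {d a₁ a₂ a₃ : k}

set_option linter.unusedSimpArgs false

set_option maxHeartbeats 3200000 in
/-- The deformed matrices compose to zero if the parameters have vanishing products, because the
words satisfy the deformed relations; in this degree the first condition is not needed. -/
theorem deformedMat_one_mul_zero (hT : IsBitensor k T) (h : DeformedRelations x y d a₁ a₂ a₃)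
    (j : Fin 2) (l : Fin 1) :
    ∑ m : Fin 2, deformedMat T x y d a₁ a₂ a₃ 1 j m * deformedMat T x y d a₁ a₂ a₃ 0 m l
      = 0 := by
  fin_cases j <;> fin_cases l <;>
    simp [deformedMat, hT.add_left, hT.add_right, hT.smul_left, hT.smul_right, hT.mul, h.xx,
      h.xxy, h.xxyx, h.xxyxy, h.yy, h.yyx, h.yxyx, h.yyxy, h.yxyxy, mul_add, add_mul, mul_assoc,
      smul_smul] <;>
    apply eq_of_one_smul k <;> match_scalars <;> first | exact CharTwo.add_self_eq_zero _ | grind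

set_option maxHeartbeats 3200000 in
theorem deformedMat_two_mul_one (hT : IsBitensor k T) (h : DeformedRelations x y d a₁ a₂ a₃)
    (h12 : a₁ * a₂ = 0) (h22 : a₂ * a₂ = 0) (h23 : a₂ * a₃ = 0) (j : Fin 1) (l : Fin 2) :
    ∑ m : Fin 2, deformedMat T x y d a₁ a₂ a₃ 2 j m * deformedMat T x y d a₁ a₂ a₃ 1 m l
      = 0 := by
  fin_cases j
  fin_cases l <;>
    simp [deformedMat, hT.add_left, hT.add_right, hT.smul_left, hT.smul_right, hT.mul, h.xx,
      h.xxy, h.xxyx, h.xxyxy, h.yy, h.yyx, h.yxyx, h.yyxy, h.yxyxy, mul_add, add_mul, mul_assoc,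
      smul_smul] <;>
    apply eq_of_one_smul k <;> match_scalars <;> first | exact CharTwo.add_self_eq_zero _ | grind

set_option maxHeartbeats 3200000 in
/-- The deformed norm element is annihilated by `x ⊗ 1 + 1 ⊗ x`, and likewise for `y`. -/
theorem deformedMat_three_mul_x (hT : IsBitensor k T) (h : DeformedRelations x y d a₁ a₂ a₃)
    (h11 : a₁ * a₁ = 0) (h12 : a₁ * a₂ = 0) (h13 : a₁ * a₃ = 0)
    (h22 : a₂ * a₂ = 0) (h23 : a₂ * a₃ = 0) (h33 : a₃ * a₃ = 0) :
    deformedMat T x y d a₁ a₂ a₃ 3 (0 : Fin 1) (0 : Fin 1) * (T x 1 + T 1 x) = 0 := by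
  simp [deformedMat, hT.add_left, hT.add_right, hT.smul_left, hT.smul_right, hT.mul, h.xx,
      h.xxy, h.xxyx, h.xxyxy, h.yy, h.yyx, h.yxyx, h.yyxy, h.yxyxy, mul_add, add_mul, mul_assoc,
      smul_smul]
  apply eq_of_one_smul k
  match_scalars <;> first | exact CharTwo.add_self_eq_zero _ | grind

set_option maxHeartbeats 3200000 in
theorem deformedMat_three_mul_y (hT : IsBitensor k T) (h : DeformedRelations x y d a₁ a₂ a₃)
    (h11 : a₁ * a₁ = 0) (h12 : a₁ * a₂ = 0) (h13 : a₁ * a₃ = 0)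
    (h22 : a₂ * a₂ = 0) (h23 : a₂ * a₃ = 0) (h33 : a₃ * a₃ = 0) :
    deformedMat T x y d a₁ a₂ a₃ 3 (0 : Fin 1) (0 : Fin 1) * (T y 1 + T 1 y) = 0 := by
  simp [deformedMat, hT.add_left, hT.add_right, hT.smul_left, hT.smul_right, hT.mul, h.xx,
      h.xxy, h.xxyx, h.xxyxy, h.yy, h.yyx, h.yxyx, h.yyxy, h.yxyxy, mul_add, add_mul, mul_assoc,
      smul_smul]
  apply eq_of_one_smul k
  match_scalars <;> first | exact CharTwo.add_self_eq_zero _ | grind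

theorem deformedMat_three_mul_two (hT : IsBitensor k T) (h : DeformedRelations x y d a₁ a₂ a₃)
    (h11 : a₁ * a₁ = 0) (h12 : a₁ * a₂ = 0) (h13 : a₁ * a₃ = 0)
    (h22 : a₂ * a₂ = 0) (h23 : a₂ * a₃ = 0) (h33 : a₃ * a₃ = 0) (j : Fin 1) (l : Fin 2) :
    ∑ m : Fin 1, deformedMat T x y d a₁ a₂ a₃ 3 j m * deformedMat T x y d a₁ a₂ a₃ 2 m l
      = 0 := by
  have h2 : (2 : k) = 0 := CharTwo.two_eq_zero
  have hx := deformedMat_three_mul_x hT h h11 h12 h13 h22 h23 h33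
  have hy := deformedMat_three_mul_y hT h h11 h12 h13 h22 h23 h33
  rw [Fin.sum_univ_one]
  fin_cases j
  fin_cases l
  · exact hx
  · set D := deformedMat T x y d a₁ a₂ a₃ 3 (0 : Fin 1) (0 : Fin 1)
    set z := (1 + a₂ * d) • (y + d • (x * (y * x))) + (a₃ * d) • x with hz
    -- `y` acts on `D` from both sides in the same way, so only the right factors matter.
    have hy' : D * T y 1 = D * T 1 y := by
      rw [mul_add] at hy
      rw [eq_neg_of_add_eq_zero_left hy, neg_eq_of_add_eq_zero_left (add_self_of_charP_two k _)]
    have hyz : D * (T y 1 * T 1 z) = D * T 1 (z * y) := by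
      rw [← mul_assoc, hy', mul_assoc, hT.mul, one_mul]
    -- `z` is `y(1 + dy)⁻¹`, that is, `z + d zy = y`.
    have hsum : y + z + d • (z * y) = 0 := by
      simp only [hz, mul_add, add_mul, smul_mul_assoc, mul_assoc, smul_add, smul_smul, h.xx, h.xxy,
        h.xxyx, h.xxyxy, h.yy, h.yyx, h.yxyx, h.yyxy, h.yxyxy, mul_smul_comm]
      apply eq_of_one_smul k
      match_scalars <;> first | exact CharTwo.add_self_eq_zero _ | grind
    have hD : D * (T y 1 + (T 1 1 + d • T y 1) * T 1 z) = 0 := by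
      have h0 : T 1 0 = 0 := by simpa using hT.smul_right 0 1 0
      rw [add_mul, mul_add, mul_add, hT.mul, one_mul, mul_one, smul_mul_assoc, mul_smul_comm, hyz,
        hy', ← mul_smul_comm, ← hT.smul_right, ← mul_add, ← mul_add, ← hT.add_right,
        ← hT.add_right, ← add_assoc, hsum, h0, mul_zero]
    have hz' : T 1 z = (1 + a₂ * d) • T 1 (y + d • (x * (y * x))) + (a₃ * d) • T 1 x := by
      rw [hz, hT.add_right, hT.smul_right, hT.smul_right]
    rw [hz'] at hD
    exact hD

set_option maxHeartbeats 3200000 in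
theorem deformedMat_four_mul_three (hT : IsBitensor k T) (h : DeformedRelations x y d a₁ a₂ a₃)
    (h11 : a₁ * a₁ = 0) (h12 : a₁ * a₂ = 0) (h13 : a₁ * a₃ = 0)
    (h22 : a₂ * a₂ = 0) (h23 : a₂ * a₃ = 0) (h33 : a₃ * a₃ = 0) (j : Fin 2) (l : Fin 1) :
    ∑ m : Fin 1, deformedMat T x y d a₁ a₂ a₃ 4 j m * deformedMat T x y d a₁ a₂ a₃ 3 m l
      = 0 := by
  fin_cases j <;> fin_cases l <;>
    simp [deformedMat, hT.add_left, hT.add_right, hT.smul_left, hT.smul_right, hT.mul, h.xx,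
      h.xxy, h.xxyx, h.xxyxy, h.yy, h.yyx, h.yxyx, h.yyxy, h.yxyxy, mul_add, add_mul, mul_assoc,
      smul_smul] <;>
    apply eq_of_one_smul k <;> match_scalars <;> first | exact CharTwo.add_self_eq_zero _ | grind

end Complex

/-! ### First-order deformations of an algebra -/

section Faces

variable (k : Type*) {A M : Type*} [CommRing k] [Ring A] [Algebra k A] [AddCommGroup M]
  [Module (A ⊗[k] Aᵐᵒᵖ) M]

theorem barD_one_apply (F : (Fin 1 → A) → M) (a b : A) :
    barD k F ![a, b] = biTens k a 1 • F ![b] + F ![a * b] + biTens k 1 b • F ![a] := by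
  have h0 : Fin.contractNth (0 : Fin 2) (· * ·) ![a, b] = ![a * b] := by
    funext i; fin_cases i; rfl
  have h1 : Fin.init ![a, b] = ![a] := by funext i; fin_cases i; rfl
  simp [barD, actLast, h0, h1]

theorem barD_two_apply (F : (Fin 2 → A) → M) (a b c : A) :
    barD k F ![a, b, c] = biTens k a 1 • F ![b, c] + (F ![a * b, c] + F ![a, b * c])
      + biTens k 1 c • F ![a, b] := by
  have h0 : Fin.contractNth (0 : Fin 3) (· * ·) ![a, b, c] = ![a * b, c] := by
    funext i; fin_cases i <;> rfl
  have h1 : Fin.contractNth (1 : Fin 3) (· * ·) ![a, b, c] = ![a, b * c] := by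
    funext i; fin_cases i <;> rfl
  have h2 : Fin.init ![a, b, c] = ![a, b] := by funext i; fin_cases i <;> rfl
  simp [barD, actLast, Fin.sum_univ_two, h0, h1, h2]

end Faces

section Deformation

theorem update_pair_zero {R : Type*} (a b v : R) : Function.update ![a, b] 0 v = ![v, b] := by
  funext i; fin_cases i <;> rfl

theorem update_pair_one {R : Type*} (a b v : R) : Function.update ![a, b] 1 v = ![a, v] := by
  funext i; fin_cases i <;> rfl

/-- A Hochschild `2`-cocycle `f` of an algebra `R`, normalized by `f(1, 1) = 0`; then
`f(1, b) = f(a, 1) = 0`, so that `1` is the unit of the deformation along `f`. -/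
structure NormalizedCocycle (K R : Type*) [Field K] [Ring R] [Algebra K R] where
  /-- The cocycle as a bilinear map. -/
  toFun : R →ₗ[K] R →ₗ[K] R
  one_one : toFun 1 1 = 0
  cocycle : ∀ a b c, a * toFun b c + toFun a (b * c) = toFun (a * b) c + toFun a b * c

variable {K R : Type*} [Field K] [Ring R] [Algebra K R]

namespace NormalizedCocycle

instance : CoeFun (NormalizedCocycle K R) fun _ => R → R → R := ⟨fun f a b => f.toFun a b⟩

/-- The normalized cocycle given by a cocycle of the Hochschild complex. -/
def ofCochain [CharP K 2] (F : Cochain K R R 2) (hF : F ∈ cocycles K R 2) (h : F ![1, 1] = 0) :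
    NormalizedCocycle K R where
  toFun := LinearMap.mk₂ K (fun a b => F ![a, b])
    (fun a a' b => by simpa only [update_pair_zero] using F.map_update_add ![a, b] 0 a a')
    (fun c a b => by simpa only [update_pair_zero] using F.map_update_smul ![a, b] 0 c a)
    (fun a b b' => by simpa only [update_pair_one] using F.map_update_add ![a, b] 1 b b')
    (fun c a b => by simpa only [update_pair_one] using F.map_update_smul ![a, b] 1 c b)
  one_one := h
  cocycle a b c := by
    have h := MultilinearMap.congr_fun (LinearMap.mem_ker.1 hF) ![a, b, c]
    rw [hochschildD_eq_barD, barD_two_apply, biTens, biTens, env_tmul_smul, env_tmul_smul,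
      one_mul, mul_one] at h
    have h2 : ∀ r : R, r + r = 0 := add_self_of_charP_two K
    simp only [LinearMap.mk₂_apply]
    rw [zero_apply] at h
    linear_combination (norm := abel) h - h2 (F ![a * b, c]) - h2 (F ![a, b] * c)

variable (f : NormalizedCocycle K R)

theorem one_left (b : R) : f 1 b = 0 := by
  have h := f.cocycle 1 1 b
  rw [f.one_one] at h
  simpa using h

theorem one_right (a : R) : f a 1 = 0 := by
  have h := f.cocycle a 1 1
  rw [f.one_one] at h
  simpa using h

/-- The first-order deformation `R ⊕ εR` of the algebra `R` along a cocycle `f`, with product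
`(a₀ + εa₁)(b₀ + εb₁) = a₀b₀ + ε(a₀b₁ + a₁b₀ + f(a₀, b₀))`. -/
def Deform (_ : NormalizedCocycle K R) : Type _ := R × R

namespace Deform

variable {f}

instance : AddCommGroup f.Deform := inferInstanceAs (AddCommGroup (R × R))

instance : Module K f.Deform := inferInstanceAs (Module K (R × R))

instance : Mul f.Deform := ⟨fun a b => (a.1 * b.1, a.1 * b.2 + a.2 * b.1 + f a.1 b.1)⟩

instance : One f.Deform := ⟨(1, 0)⟩

@[ext]
theorem ext {a b : f.Deform} (h1 : a.1 = b.1) (h2 : a.2 = b.2) : a = b := Prod.ext h1 h2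

@[simp] theorem fst_mul (a b : f.Deform) : (a * b).1 = a.1 * b.1 := rfl
@[simp] theorem snd_mul (a b : f.Deform) :
    (a * b).2 = a.1 * b.2 + a.2 * b.1 + f a.1 b.1 := rfl
@[simp] theorem fst_one : (1 : f.Deform).1 = 1 := rfl
@[simp] theorem snd_one : (1 : f.Deform).2 = 0 := rfl
@[simp] theorem fst_zero : (0 : f.Deform).1 = 0 := rfl
@[simp] theorem snd_zero : (0 : f.Deform).2 = 0 := rfl
@[simp] theorem fst_add (a b : f.Deform) : (a + b).1 = a.1 + b.1 := rfl
@[simp] theorem snd_add (a b : f.Deform) : (a + b).2 = a.2 + b.2 := rfl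
@[simp] theorem fst_ksmul (c : K) (a : f.Deform) : (c • a).1 = c • a.1 := rfl
@[simp] theorem snd_ksmul (c : K) (a : f.Deform) : (c • a).2 = c • a.2 := rfl

instance : Ring f.Deform where
  __ := (inferInstance : AddCommGroup f.Deform)
  left_distrib a b c := by
    ext <;> simp [mul_add]
    abel
  right_distrib a b c := by
    ext <;> simp [add_mul]
    abel
  zero_mul a := by ext <;> simp
  mul_zero a := by ext <;> simp
  one_mul a := by ext <;> simp [one_left]
  mul_one a := by ext <;> simp [one_right]
  mul_assoc a b c := by
    ext
    · simp [mul_assoc]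
    · simp only [snd_mul, fst_mul, mul_add, add_mul, mul_assoc]
      linear_combination (norm := abel) - f.cocycle a.1 b.1 c.1

section Scalars

/-- The action `(s + εt)(a + εb) = sa + ε(sb + ta)` of the dual numbers. -/
abbrev dualSMul : SMul (DualNumber K) f.Deform :=
  ⟨fun t a => (t.fst • a.1, t.fst • a.2 + t.snd • a.1)⟩

attribute [local instance] dualSMul

theorem fst_dualSMul (t : DualNumber K) (a : f.Deform) : (t • a).1 = t.fst • a.1 := rfl
theorem snd_dualSMul (t : DualNumber K) (a : f.Deform) :
    (t • a).2 = t.fst • a.2 + t.snd • a.1 := rfl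

attribute [local simp] fst_dualSMul snd_dualSMul

/-- The deformation as a module over the dual numbers. -/
abbrev dualModule : Module (DualNumber K) f.Deform where
  one_smul a := by ext <;> simp
  mul_smul s t a := by
    ext
    · simp [mul_smul]
    · simp [mul_smul, add_smul, smul_add, add_assoc]
  smul_zero t := by ext <;> simp
  smul_add t a b := by
    ext
    · simp
    · simp only [snd_dualSMul, snd_add, fst_add, smul_add]; abel
  add_smul s t a := by
    ext
    · simp [add_smul]
    · simp only [snd_dualSMul, snd_add, TrivSqZeroExt.fst_add, TrivSqZeroExt.snd_add,
        add_smul]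
      abel
  zero_smul a := by ext <;> simp

attribute [local instance] dualModule

/-- The deformation as an algebra over the dual numbers. -/
abbrev dualAlgebra : Algebra (DualNumber K) f.Deform :=
  Algebra.ofModule
    (fun t a b => by
      ext
      · simp
      · simp only [snd_dualSMul, snd_mul, fst_mul, fst_dualSMul, smul_add, map_smul,
          LinearMap.smul_apply, smul_mul_assoc, add_mul]
        abel)
    (fun t a b => by
      ext
      · simp
      · simp only [snd_dualSMul, snd_mul, fst_mul, fst_dualSMul, smul_add, map_smul,
          mul_smul_comm, mul_add]
        abel)

end Scalars

instance : Algebra (DualNumber K) f.Deform := dualAlgebra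

@[simp] theorem fst_smul (t : DualNumber K) (a : f.Deform) : (t • a).1 = t.fst • a.1 := rfl
@[simp] theorem snd_smul (t : DualNumber K) (a : f.Deform) :
    (t • a).2 = t.fst • a.2 + t.snd • a.1 := rfl

instance : IsScalarTower K (DualNumber K) f.Deform where
  smul_assoc c t a := by
    ext
    · simp [mul_smul]
    · simp [mul_smul]

instance : SMulCommClass K (DualNumber K) f.Deform where
  smul_comm c t a := by
    ext
    · simp [smul_comm c t.fst a.1]
    · simp [smul_comm c t.fst a.2, smul_comm c t.snd a.1]

instance : SMulCommClass (DualNumber K) K f.Deform := SMulCommClass.symm _ _ _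

/-- The linear inclusion `a ↦ a + ε0`, which is not multiplicative. -/
def incl (f : NormalizedCocycle K R) : R →ₗ[K] f.Deform := LinearMap.inl K R R

@[simp] theorem fst_incl (a : R) : (incl f a).1 = a := rfl
@[simp] theorem snd_incl (a : R) : (incl f a).2 = 0 := rfl

theorem eps_smul (a : f.Deform) : (DualNumber.eps : DualNumber K) • a = (0, a.1) := by
  refine Deform.ext ?_ ?_
  · simp
  · simp

theorem eq_incl_add (a : f.Deform) :
    a = incl f a.1 + (DualNumber.eps : DualNumber K) • incl f a.2 := by
  ext <;> simp

theorem incl_mul_incl (a b : R) :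
    incl f a * incl f b = incl f (a * b) + (DualNumber.eps : DualNumber K) • incl f (f a b) := by
  ext <;> simp

/-- The extension of a `K`-linear map defined on `R` to a linear map over the dual numbers. -/
def extend {M : Type*} [AddCommGroup M] [Module K M] [Module (DualNumber K) M]
    [IsScalarTower K (DualNumber K) M] (g : R →ₗ[K] M) : f.Deform →ₗ[DualNumber K] M where
  toFun a := g a.1 + (DualNumber.eps : DualNumber K) • g a.2
  map_add' a b := by simp only [fst_add, snd_add, map_add, smul_add]; abel
  map_smul' t a := by
    have ht : t = t.fst • (1 : DualNumber K) + t.snd • DualNumber.eps := by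
      ext <;> simp
    have h1 : ∀ (c : K) (m : M), c • (DualNumber.eps : DualNumber K) • m
        = (DualNumber.eps : DualNumber K) • c • m := fun c m => by
      rw [← smul_one_smul (DualNumber K) c m, smul_smul, ← smul_assoc, mul_smul_comm, mul_one]
    have h2 : ∀ m : M, (DualNumber.eps : DualNumber K) • (DualNumber.eps : DualNumber K) • m = 0 :=
      fun m => by rw [smul_smul, DualNumber.eps_mul_eps, zero_smul]
    simp only [fst_smul, snd_smul, map_add, map_smul, smul_add, RingHom.id_apply]
    conv_rhs => rw [ht]
    simp only [add_smul, smul_assoc, one_smul, h1, h2, smul_zero, add_zero]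
    abel

end Deform

end NormalizedCocycle

end Deformation

/-! ### The cocycles of the combinations of `w₁`, `w₂`, `w₃` -/

instance (K : Type*) [Field K] [CharP K 2] : CharP (DualNumber K) 2 :=
  charP_of_injective_algebraMap (algebraMap K (DualNumber K)).injective 2

namespace R20

section Values

variable {K : Type*} [Field K] {d : K}

theorem biTens_smul_single {n : ℕ} (j : Fin (rk n)) (a b a' b' : R20 K d) :
    biTens K a b • (Pi.single j (biTens K a' b') : P K d n)
      = Pi.single j (biTens K (a * a') (b' * b)) := by
  funext l
  rw [Pi.smul_apply]
  obtain rfl | h := eq_or_ne l j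
  · rw [Pi.single_eq_same, Pi.single_eq_same, smul_eq_mul, biTens_mul]
  · rw [Pi.single_eq_of_ne h, Pi.single_eq_of_ne h, smul_eq_mul, mul_zero]

theorem gen_eq_single (j : Fin (rk 0)) : gen K d = Pi.single j (biTens K 1 1) := by
  funext i
  obtain rfl : j = i := Subsingleton.elim (α := Fin 1) _ _
  rw [Pi.single_eq_same, gen_apply]

theorem zero_env_smul (r : R20 K d) : (0 : Env K (R20 K d)) • r = 0 := by
  have h : (0 : Env K (R20 K d)) = tens 0 1 := (TensorProduct.zero_tmul _ _).symm
  rw [h, tens_smul, zero_mul]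

variable [CharP K 2]

theorem contr_gen_shortWord (i : Fin 8) (l : Fin (rk 1)) :
    contr K d 0 (biTens K 1 (shortWord (x K d) (y K d) i) • gen K d) l
      = contrCoef K d 0 (0 : Fin 1) l i := by
  have h (j : Fin (rk 0)) : contr K d 0 (biTens K 1 (shortWord (x K d) (y K d) i) • gen K d) l
      = contrCoef K d 0 j l i := by
    rw [gen_eq_single j, biTens_smul_single, one_mul, one_mul, contr_single]
  exact h (0 : Fin 1)

theorem contr_gen_x : contr K d 0 (biTens K 1 (x K d) • gen K d)
    = Pi.single (0 : Fin 2) (biTens K 1 1) := by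
  funext l
  refine (contr_gen_shortWord 1 l).trans ?_
  revert l
  change ∀ l : Fin 2, _
  intro l
  fin_cases l <;> rfl

theorem contr_gen_y : contr K d 0 (biTens K 1 (y K d) • gen K d)
    = Pi.single (1 : Fin 2) (biTens K 1 1) := by
  funext l
  refine (contr_gen_shortWord 2 l).trans ?_
  revert l
  change ∀ l : Fin 2, _
  intro l
  fin_cases l <;> rfl

theorem pull_two_apply (w : P K d 2 →ₗ[Env K (R20 K d)] R20 K d) (a b : R20 K d) :
    (stdComparison K d).pull w ![a, b]
      = w (contr K d 1 (biTens K 1 b • contr K d 0 (biTens K 1 a • gen K d))) := rfl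

/-- On a generator `a` whose contraction is a basis element of `P₁`, the cocycle of a map on `P₂` is
read off the coefficients of the contraction. -/
theorem pull_generator_shortWord (r : Fin (rk 2) → R20 K d) {a : R20 K d} {j : Fin (rk 1)}
    (ha : contr K d 0 (biTens K 1 a • gen K d) = Pi.single j (biTens K 1 1)) (i : Fin 8) :
    (stdComparison K d).pull (ofValues 2 r) ![a, shortWord (x K d) (y K d) i]
      = ∑ l, contrCoef K d 1 j l i • r l := by
  rw [pull_two_apply, ha, ofValues, Fintype.linearCombination_apply, biTens_smul_single, mul_one,
    one_mul]
  simp only [contr_single]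

/-- The values on the generators of the combination `c₁w₁ + c₂w₂ + c₃w₃`. -/
def wVal (d : K) (c₁ c₂ c₃ : K) : Fin 2 → R20 K d :=
  ![c₁ • x K d + c₃ • y K d, c₂ • y K d + c₃ • (x K d + d • (x K d * y K d))]

variable (c₁ c₂ c₃ : K)

theorem ofValues_wVal : ofValues 2 (wVal d c₁ c₂ c₃)
    = c₁ • (w₁ K d).1 + c₂ • (w₂ K d).1 + c₃ • (w₃ K d).1 := by
  refine LinearMap.ext fun z => ?_
  change ∑ l : Fin 2, z l • wVal d c₁ c₂ c₃ l = c₁ • (∑ l : Fin 2, z l • _)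
    + c₂ • (∑ l : Fin 2, z l • _) + c₃ • (∑ l : Fin 2, z l • _)
  have h (c : K) (z : Env K (R20 K d)) (r : R20 K d) : z • c • r = c • z • r := smul_comm z c r
  simp [Fin.sum_univ_two, wVal, smul_add, h]
  abel

/-- The combination `c₁w₁ + c₂w₂ + c₃w₃`. -/
def wComb (d : K) (c₁ c₂ c₃ : K) : CocycleP K d 2 :=
  ⟨ofValues 2 (wVal d c₁ c₂ c₃), by
    rw [ofValues_wVal]
    refine LinearMap.ext fun z => ?_
    have h1 := LinearMap.congr_fun (w₁ K d).2 z
    have h2 := LinearMap.congr_fun (w₂ K d).2 z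
    have h3 := LinearMap.congr_fun (w₃ K d).2 z
    simp only [LinearMap.comp_apply] at h1 h2 h3
    simp [h1, h2, h3]⟩

theorem pull_one_one (w : P K d 2 →ₗ[Env K (R20 K d)] R20 K d) :
    ((stdComparison K d).pull w : Cochain K (R20 K d) (R20 K d) 2) ![1, 1] = 0 := by
  have h : contr K d 0 (biTens K (1 : R20 K d) 1 • gen K d) = 0 := by
    funext l
    refine (contr_gen_shortWord 0 l).trans ?_
    revert l
    change ∀ l : Fin 2, _
    intro l
    fin_cases l <;> rfl
  have h0 : (biTens K (1 : R20 K d) 1 • 0 : P K d 1) = 0 := funext fun _ => mul_zero _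
  rw [pull_two_apply, h, h0, map_zero, map_zero]

/-- The normalized Hochschild cocycle of `c₁w₁ + c₂w₂ + c₃w₃`. -/
noncomputable def wCocycle (d : K) (c₁ c₂ c₃ : K) : NormalizedCocycle K (R20 K d) :=
  .ofCochain ((stdComparison K d).pull (wComb d c₁ c₂ c₃).1) (Comparison.pull_mem _ _)
    (pull_one_one _)

theorem wCocycle_x_shortWord (i : Fin 8) :
    wCocycle d c₁ c₂ c₃ (x K d) (shortWord (x K d) (y K d) i)
      = ∑ l : Fin 2, contrCoef K d 1 (0 : Fin 2) l i • wVal d c₁ c₂ c₃ l :=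
  pull_generator_shortWord _ contr_gen_x i

theorem wCocycle_y_shortWord (i : Fin 8) :
    wCocycle d c₁ c₂ c₃ (y K d) (shortWord (x K d) (y K d) i)
      = ∑ l : Fin 2, contrCoef K d 1 (1 : Fin 2) l i • wVal d c₁ c₂ c₃ l :=
  pull_generator_shortWord _ contr_gen_y i

open NormalizedCocycle.Deform

section Table

attribute [local simp] contrCoef wVal add_smul tens_smul mul_add mul_assoc xx xxy xxyx xxyxy yy yyx
  yyxy yxyx yxyxy smul_smul zero_env_smul

theorem wCocycle_x_x : wCocycle d c₁ c₂ c₃ (x K d) (x K d)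
    = c₁ • x K d + c₃ • y K d := by
  refine (wCocycle_x_shortWord c₁ c₂ c₃ 1).trans ?_
  simp

theorem wCocycle_x_y : wCocycle d c₁ c₂ c₃ (x K d) (y K d)
    = 0 := by
  refine (wCocycle_x_shortWord c₁ c₂ c₃ 2).trans ?_
  simp

theorem wCocycle_x_xy : wCocycle d c₁ c₂ c₃ (x K d) (x K d * y K d)
    = c₁ • (x K d * y K d) + (c₁ + c₃ * d) • (x K d * (y K d * (x K d * y K d)))
      + c₂ • (y K d * (x K d * y K d)) + c₃ • (x K d * (y K d * x K d)) := by
  refine (wCocycle_x_shortWord c₁ c₂ c₃ 3).trans ?_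
  simp
  apply eq_of_one_smul K
  match_scalars <;> grind

theorem wCocycle_x_yx : wCocycle d c₁ c₂ c₃ (x K d) (y K d * x K d)
    = 0 := by
  refine (wCocycle_x_shortWord c₁ c₂ c₃ 4).trans ?_
  simp

theorem wCocycle_x_xyx : wCocycle d c₁ c₂ c₃ (x K d) (x K d * (y K d * x K d))
    = c₁ • (x K d * (y K d * x K d)) + c₂ • (x K d * (y K d * (x K d * y K d))) := by
  refine (wCocycle_x_shortWord c₁ c₂ c₃ 5).trans ?_
  simp

theorem wCocycle_x_yxy : wCocycle d c₁ c₂ c₃ (x K d) (y K d * (x K d * y K d))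
    = 0 := by
  refine (wCocycle_x_shortWord c₁ c₂ c₃ 6).trans ?_
  simp

theorem wCocycle_x_xyxy : wCocycle d c₁ c₂ c₃ (x K d) (x K d * (y K d * (x K d * y K d)))
    = c₁ • (x K d * (y K d * (x K d * y K d))) := by
  refine (wCocycle_x_shortWord c₁ c₂ c₃ 7).trans ?_
  simp

theorem wCocycle_y_x : wCocycle d c₁ c₂ c₃ (y K d) (x K d)
    = 0 := by
  refine (wCocycle_y_shortWord c₁ c₂ c₃ 1).trans ?_
  simp

theorem wCocycle_y_y : wCocycle d c₁ c₂ c₃ (y K d) (y K d)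
    = c₂ • y K d + c₃ • x K d + (c₃ * d) • (x K d * y K d) := by
  refine (wCocycle_y_shortWord c₁ c₂ c₃ 2).trans ?_
  simp
  apply eq_of_one_smul K
  match_scalars <;> grind

theorem wCocycle_y_xy : wCocycle d c₁ c₂ c₃ (y K d) (x K d * y K d)
    = 0 := by
  refine (wCocycle_y_shortWord c₁ c₂ c₃ 3).trans ?_
  simp

theorem wCocycle_y_yx : wCocycle d c₁ c₂ c₃ (y K d) (y K d * x K d)
    = c₁ • (x K d * (y K d * x K d)) + (c₁ * d + c₂) • (x K d * (y K d * (x K d * y K d)))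
      + c₂ • (y K d * x K d) + c₃ • (y K d * (x K d * y K d)) := by
  refine (wCocycle_y_shortWord c₁ c₂ c₃ 4).trans ?_
  simp
  apply eq_of_one_smul K
  match_scalars <;> grind

theorem wCocycle_y_xyx : wCocycle d c₁ c₂ c₃ (y K d) (x K d * (y K d * x K d))
    = c₃ • (y K d * x K d) + c₃ • (x K d * y K d) := by
  refine (wCocycle_y_shortWord c₁ c₂ c₃ 5).trans ?_
  simp
  apply eq_of_one_smul K
  match_scalars <;> grind

theorem wCocycle_y_yxy : wCocycle d c₁ c₂ c₃ (y K d) (y K d * (x K d * y K d))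
    = c₁ • (x K d * (y K d * (x K d * y K d))) + c₂ • (y K d * (x K d * y K d)) := by
  refine (wCocycle_y_shortWord c₁ c₂ c₃ 6).trans ?_
  simp
  apply eq_of_one_smul K
  match_scalars <;> grind

theorem wCocycle_y_xyxy : wCocycle d c₁ c₂ c₃ (y K d) (x K d * (y K d * (x K d * y K d)))
    = c₂ • (x K d * (y K d * (x K d * y K d))) + c₃ • (y K d * (x K d * y K d)) := by
  refine (wCocycle_y_shortWord c₁ c₂ c₃ 7).trans ?_
  simp
  apply eq_of_one_smul K
  match_scalars <;> grind

end Table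

/-- The deformation of `R(2, 0, d)` along the cocycle of `c₁w₁ + c₂w₂ + c₃w₃` satisfies the deformed
relations with parameters `cᵢε`. -/
theorem deformedRelations_wCocycle :
    DeformedRelations (incl (wCocycle d c₁ c₂ c₃) (x K d)) (incl (wCocycle d c₁ c₂ c₃) (y K d))
      (algebraMap K (DualNumber K) d) (c₁ • DualNumber.eps) (c₂ • DualNumber.eps)
      (c₃ • DualNumber.eps) := by
  have hd : (algebraMap K (DualNumber K) d).fst = d := rfl
  constructor <;> ext <;>
    simp [xx, xxy, xxyx, xxyxy, yy, yyx, yyxy, yxyx, yxyxy, wCocycle_x_x, wCocycle_x_y,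
      wCocycle_x_xy, wCocycle_x_yx, wCocycle_x_xyx, wCocycle_x_yxy, wCocycle_x_xyxy, wCocycle_y_x,
      wCocycle_y_y, wCocycle_y_xy, wCocycle_y_yx, wCocycle_y_xyx, wCocycle_y_yxy, wCocycle_y_xyxy,
      hd, smul_smul]

end Values

end R20

/-! ### Perturbed contractions and the enveloping algebra of a deformation -/

/-- Induction on the elements of the enveloping algebra, over the pure tensors `a ⊗ b`. -/
theorem biTens_induction {k A : Type*} [CommRing k] [Ring A] [Algebra k A]
    {motive : A ⊗[k] Aᵐᵒᵖ → Prop} (zero : motive 0) (biTens : ∀ a b, motive (biTens k a b))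
    (add : ∀ u v, motive u → motive v → motive (u + v)) (z : A ⊗[k] Aᵐᵒᵖ) : motive z :=
  TensorProduct.induction_on z zero (fun a b => biTens a (unop b)) add

section Perturbation

variable {k : Type*} [CommRing k] {M : ℕ → Type*} [∀ n, AddCommGroup (M n)]
  [∀ n, Module k (M n)] (D : ∀ n, M (n + 1) →ₗ[k] M n) (t : ∀ n, M n →ₗ[k] M (n + 1))
  (p : M 0 →ₗ[k] M 0)

/-- The endomorphism `Dt + tD` of a complex, which in degree zero is `Dt + p` for `p` the
augmentation followed by a section of it.  It is the identity if `t` is a contraction. -/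
def contractionDefect : (n : ℕ) → M n →ₗ[k] M n
  | 0 => D 0 ∘ₗ t 0 + p
  | n + 1 => D (n + 1) ∘ₗ t (n + 1) + t n ∘ₗ D n

variable {D t p}

theorem contractionDefect_diff (hD : ∀ n z, D n (D (n + 1) z) = 0) (hpD : ∀ z, p (D 0 z) = 0)
    (n : ℕ) (z : M (n + 1)) : contractionDefect D t p n (D n z) = D n (t n (D n z)) := by
  cases n with
  | zero => simp [contractionDefect, hpD]
  | succ n => simp [contractionDefect, hD]

theorem diff_contractionDefect (hD : ∀ n z, D n (D (n + 1) z) = 0) (n : ℕ) (z : M (n + 1)) :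
    D n (contractionDefect D t p (n + 1) z) = D n (t n (D n z)) := by
  simp [contractionDefect, hD]

/-- In characteristic two, an endomorphism congruent to the identity modulo an element of square
zero is an involution. -/
theorem involutive_of_congr_id [CharP k 2] {N : Type*} [AddCommGroup N] [Module k N]
    {ε : k} (hε : ε * ε = 0) {c : N →ₗ[k] N} (hc : ∀ z, ∃ w, c z = z + ε • w) (z : N) :
    c (c z) = z := by
  obtain ⟨w, hw⟩ := hc z
  obtain ⟨v, hv⟩ := hc w
  have h0 : ε • ε • v = 0 := by rw [smul_smul, hε, zero_smul]
  rw [hw, map_add, map_smul, hw, hv, smul_add, h0, add_zero, add_assoc, add_self_of_charP_two k,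
    add_zero]

/-- Composing with the defect corrects a map that is a contraction modulo an element of square
zero. -/
theorem diff_corrected_zero [CharP k 2] (hpD : ∀ z, p (D 0 z) = 0) (hpp : ∀ z, p (p z) = p z)
    {ε : k} (hε : ε * ε = 0) (hc : ∀ z, ∃ w, contractionDefect D t p 0 z = z + ε • w) (z : M 0) :
    D 0 (t 0 (contractionDefect D t p 0 z)) + p z = z := by
  -- The defect `c` is an involution and satisfies `pc = p`, so `Dtc + p = (Dt + p)c = c² = 1`.
  have h := involutive_of_congr_id hε hc z
  have h1 : p (contractionDefect D t p 0 z) = p z := by simp [contractionDefect, hpD, hpp]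
  conv_rhs => rw [← h]
  rw [← h1]
  rfl

theorem diff_corrected_succ [CharP k 2] (hD : ∀ n z, D n (D (n + 1) z) = 0)
    (hpD : ∀ z, p (D 0 z) = 0) {ε : k} (hε : ε * ε = 0) (n : ℕ)
    (hc : ∀ z, ∃ w, contractionDefect D t p (n + 1) z = z + ε • w) (z : M (n + 1)) :
    D (n + 1) (t (n + 1) (contractionDefect D t p (n + 1) z))
      + t n (contractionDefect D t p n (D n z)) = z := by
  -- The defect `c` commutes with `D`, so `Dtc + tcD = (Dt + tD)c = c² = 1`.
  have h := involutive_of_congr_id hε hc z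
  conv_rhs => rw [← h]
  rw [contractionDefect_diff hD hpD, ← diff_contractionDefect (p := p) hD]
  rfl

end Perturbation

namespace NormalizedCocycle

variable {K R : Type*} [Field K] [Ring R] [Algebra K R] (f : NormalizedCocycle K R)

/-- The enveloping algebra of the deformation along `f`, over the dual numbers. -/
abbrev DeformEnv : Type _ := f.Deform ⊗[DualNumber K] f.Deformᵐᵒᵖ

namespace Deform

variable {f}

instance : Module f.DeformEnv f.Deform := TensorProduct.Algebra.module

theorem biTens_smul_deform (a b r : f.Deform) : biTens (DualNumber K) a b • r = a * r * b := by
  change a * (r * b) = a * r * b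
  rw [mul_assoc]

instance : IsScalarTower (DualNumber K) f.DeformEnv f.Deform where
  smul_assoc := fun r ab a => by
    change TensorProduct.Algebra.moduleAux _ _ = _ • TensorProduct.Algebra.moduleAux _ _
    simp

variable (f) in
/-- Reduction of the enveloping algebra of the deformation modulo `ε`. -/
noncomputable def envFst : f.DeformEnv →+ Env K R :=
  TensorProduct.liftAddHom
    (AddMonoidHom.mk' (fun a : f.Deform => AddMonoidHom.mk'
        (fun b : f.Deformᵐᵒᵖ => biTens K a.1 (unop b).1) fun b b' => biTens_add_right K _ _ _)
      fun a a' => AddMonoidHom.ext fun b => biTens_add_left K _ _ _)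
    fun t a b => by
      change biTens K (t • a).1 (unop b).1 = biTens K a.1 (t • unop b).1
      simp [biTens_smul_left, biTens_smul_right]

@[simp]
theorem envFst_biTens (a b : f.Deform) :
    envFst f (biTens (DualNumber K) a b) = biTens K a.1 b.1 := rfl

@[simp]
theorem envFst_mul (u v : f.DeformEnv) : envFst f (u * v) = envFst f u * envFst f v := by
  induction u using biTens_induction with
  | zero => simp
  | add u u' hu hu' => rw [add_mul, map_add, map_add, add_mul, hu, hu']
  | biTens a b =>
    induction v using biTens_induction with
    | zero => simp
    | add v v' hv hv' => rw [mul_add, map_add, map_add, mul_add, hv, hv']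
    | biTens a' b' => simp only [biTens_mul, envFst_biTens, fst_mul]

@[simp]
theorem envFst_smul (t : DualNumber K) (u : f.DeformEnv) :
    envFst f (t • u) = t.fst • envFst f u := by
  induction u using biTens_induction with
  | zero => simp
  | add u u' hu hu' => rw [smul_add, map_add, map_add, smul_add, hu, hu']
  | biTens a b =>
    rw [← biTens_smul_left, envFst_biTens, fst_smul, biTens_smul_left, envFst_biTens]

@[simp]
theorem envFst_ksmul (c : K) (u : f.DeformEnv) : envFst f (c • u) = c • envFst f u := by
  rw [← smul_one_smul (DualNumber K) c u, envFst_smul]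
  simp

theorem fst_env_smul (u : f.DeformEnv) (r : f.Deform) : (u • r).1 = envFst f u • r.1 := by
  induction u using biTens_induction with
  | zero =>
    rw [map_zero]
    exact (congrArg Prod.fst (zero_smul f.DeformEnv r)).trans (zero_smul (Env K R) r.1).symm
  | add u u' hu hu' => rw [add_smul, map_add, add_smul, fst_add, hu, hu']
  | biTens a b =>
    rw [biTens_smul_deform, envFst_biTens]
    exact (env_tmul_smul a.1 b.1 r.1).symm

variable (f) in
/-- The linear lift `a ⊗ b ↦ (a + ε0) ⊗ (b + ε0)` of the enveloping algebra. -/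
noncomputable def envIncl : Env K R →ₗ[K] f.DeformEnv :=
  TensorProduct.lift <| LinearMap.mk₂ K
    (fun a b => biTens (DualNumber K) (incl f a) (incl f (unop b)))
    (fun a a' b => by rw [map_add, biTens_add_left])
    (fun c a b => by rw [map_smul]; rfl)
    (fun a b b' => by rw [unop_add, map_add, biTens_add_right])
    (fun c a b => by
      have h : ∀ r : f.Deform, c • r = (c • (1 : DualNumber K)) • r := fun r => by
        rw [smul_assoc, one_smul]
      rw [unop_smul, map_smul, h, biTens_smul_right, smul_assoc, one_smul])

theorem envIncl_biTens (a b : R) :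
    envIncl f (biTens K a b) = biTens (DualNumber K) (incl f a) (incl f b) := by
  simp [envIncl, biTens]

theorem envFst_envIncl (u : Env K R) : envFst f (envIncl f u) = u := by
  induction u using biTens_induction with
  | zero => simp
  | add u u' hu hu' => rw [map_add, map_add, hu, hu']
  | biTens a b => rw [envIncl_biTens]; rfl

theorem exists_eq_envIncl_add (z : f.DeformEnv) :
    ∃ w, z = envIncl f (envFst f z) + (DualNumber.eps : DualNumber K) • w := by
  induction z using biTens_induction with
  | zero => exact ⟨0, by simp⟩
  | add u v hu hv =>
    obtain ⟨w, hw⟩ := hu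
    obtain ⟨w', hw'⟩ := hv
    refine ⟨w + w', ?_⟩
    rw [map_add, map_add, smul_add]
    nth_rw 1 [hw, hw']
    abel
  | biTens a b =>
    refine ⟨biTens _ (incl f a.2) b + biTens _ (incl f a.1) (incl f b.2), ?_⟩
    rw [envFst_biTens, envIncl_biTens, smul_add, ← biTens_smul_left, ← biTens_smul_right]
    nth_rw 1 [eq_incl_add a]
    rw [biTens_add_left]
    nth_rw 1 [eq_incl_add b]
    rw [biTens_add_right]
    abel

/-- The kernel of the reduction modulo `ε` consists of the multiples of `ε`. -/
theorem exists_eq_eps_smul {z : f.DeformEnv} (hz : envFst f z = 0) :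
    ∃ w, z = (DualNumber.eps : DualNumber K) • w := by
  obtain ⟨w, hw⟩ := exists_eq_envIncl_add z
  exact ⟨w, by rw [hw, hz, map_zero, zero_add]⟩

end Deform

end NormalizedCocycle

/-! ### The deformed resolution -/

namespace R20

open NormalizedCocycle NormalizedCocycle.Deform

variable {K : Type*} [Field K] {d : K}

section Complex

variable (f : NormalizedCocycle K (R20 K d)) (c₁ c₂ c₃ : K)

/-- The terms of the deformed resolution: free bimodules over the deformation, of the same ranks as
the terms of `P`. -/
abbrev DeformP (n : ℕ) : Type _ := Fin (rk n) → f.DeformEnv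

/-- The matrices of the deformed resolution over the deformation of `R(2, 0, d)` along `f`. -/
def deformMat (n : ℕ) : Matrix (Fin (rk (n + 1))) (Fin (rk n)) f.DeformEnv :=
  deformedMat (biTens (DualNumber K)) (incl f (x K d)) (incl f (y K d))
    (algebraMap K (DualNumber K) d) (c₁ • DualNumber.eps) (c₂ • DualNumber.eps)
    (c₃ • DualNumber.eps) n

/-- The differentials of the deformed resolution. -/
def deformDiff (n : ℕ) : DeformP f (n + 1) →ₗ[f.DeformEnv] DeformP f n :=
  (deformMat f c₁ c₂ c₃ n).vecMulLinear

theorem deformDiff_apply (n : ℕ) (z : DeformP f (n + 1)) (i : Fin (rk n)) :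
    deformDiff f c₁ c₂ c₃ n z i = ∑ j, z j * deformMat f c₁ c₂ c₃ n j i := rfl

/-- The deformation along `f` satisfies the deformed relations with parameters `cᵢε`. -/
abbrev HasDeformedRelations : Prop :=
  DeformedRelations (incl f (x K d)) (incl f (y K d)) (algebraMap K (DualNumber K) d)
    (c₁ • DualNumber.eps) (c₂ • DualNumber.eps) (c₃ • DualNumber.eps)

theorem smul_eps_mul_smul_eps (a b : K) :
    (a • DualNumber.eps : DualNumber K) * (b • DualNumber.eps) = 0 := by
  rw [smul_mul_smul_comm, DualNumber.eps_mul_eps, smul_zero]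

variable {f c₁ c₂ c₃}

theorem deformMat_mul_deformMat [CharP K 2]
    (h : HasDeformedRelations f c₁ c₂ c₃) :
    (n : ℕ) → (j : Fin (rk (n + 2))) → (l : Fin (rk n)) →
      ∑ m, deformMat f c₁ c₂ c₃ (n + 1) j m * deformMat f c₁ c₂ c₃ n m l = 0
  | 0, j, l => deformedMat_one_mul_zero (isBitensor_biTens _ _) h j l
  | 1, j, l => deformedMat_two_mul_one (isBitensor_biTens _ _) h (smul_eps_mul_smul_eps _ _)
    (smul_eps_mul_smul_eps _ _) (smul_eps_mul_smul_eps _ _) j l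
  | 2, j, l => deformedMat_three_mul_two (isBitensor_biTens _ _) h (smul_eps_mul_smul_eps _ _)
    (smul_eps_mul_smul_eps _ _) (smul_eps_mul_smul_eps _ _) (smul_eps_mul_smul_eps _ _)
    (smul_eps_mul_smul_eps _ _) (smul_eps_mul_smul_eps _ _) j l
  | 3, j, l => deformedMat_four_mul_three (isBitensor_biTens _ _) h (smul_eps_mul_smul_eps _ _)
    (smul_eps_mul_smul_eps _ _) (smul_eps_mul_smul_eps _ _) (smul_eps_mul_smul_eps _ _)
    (smul_eps_mul_smul_eps _ _) (smul_eps_mul_smul_eps _ _) j l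
  | n + 4, j, l => deformMat_mul_deformMat h n j l

theorem deformDiff_deformDiff [CharP K 2]
    (h : HasDeformedRelations f c₁ c₂ c₃) (n : ℕ) (z : DeformP f (n + 2)) :
    deformDiff f c₁ c₂ c₃ n (deformDiff f c₁ c₂ c₃ (n + 1) z) = 0 := by
  funext l
  simp only [deformDiff_apply, Finset.sum_mul, mul_assoc]
  rw [Finset.sum_comm]
  simp only [← Finset.mul_sum, deformMat_mul_deformMat h, mul_zero, Finset.sum_const_zero]
  rfl

set_option maxHeartbeats 1000000 in
attribute [local simp] deformMat deformedMat dMat tens_eq mul_assoc biTens_add_right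
  biTens_smul_right add_mul mul_add biTens_mul smul_mul_env mul_smul_env smul_smul sq in
/-- Modulo `ε` the deformed matrices are those of the resolution `P`. -/
theorem envFst_deformMat : (n : ℕ) → (j : Fin (rk (n + 1))) → (l : Fin (rk n)) →
    envFst f (deformMat f c₁ c₂ c₃ n j l) = dMat K d n j l
  | 0 => by
    change ∀ (j : Fin 2) (l : Fin 1), _
    intro j l
    fin_cases j <;> fin_cases l <;> simp
  | 1 => by
    change ∀ (j : Fin 2) (l : Fin 2), _
    intro j l
    fin_cases j <;> fin_cases l <;> simp
  | 2 => by
    change ∀ (j : Fin 1) (l : Fin 2), _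
    intro j l
    fin_cases j <;> fin_cases l <;> simp
    abel
  | 3 => by
    change ∀ (j : Fin 1) (l : Fin 1), _
    intro j l
    fin_cases j
    fin_cases l
    simp
    abel
  | n + 4 => fun j l => envFst_deformMat n j l

end Complex

end R20

/-! ### Lifting the contraction to the deformed resolution -/

namespace R20

open NormalizedCocycle NormalizedCocycle.Deform

variable {K : Type*} [Field K] {d : K}

section Contraction

variable {f : NormalizedCocycle K (R20 K d)}

/-- Reduction of the deformed resolution modulo `ε`. -/
noncomputable def reduce (n : ℕ) (z : DeformP f n) : P K d n := fun i => envFst f (z i)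

theorem reduce_add {n : ℕ} (z w : DeformP f n) :
    reduce n (z + w) = reduce n z + reduce n w := funext fun _ => map_add _ _ _

theorem reduce_smul {n : ℕ} (u : f.DeformEnv) (z : DeformP f n) :
    reduce n (u • z) = envFst f u • reduce n z := funext fun _ => envFst_mul _ _

theorem exists_eq_add_eps_smul {n : ℕ} {z w : DeformP f n} (h : reduce n z = reduce n w) :
    ∃ v, z = w + (DualNumber.eps : DualNumber K) • v := by
  have h1 (i) : ∃ v, z i - w i = (DualNumber.eps : DualNumber K) • v :=
    exists_eq_eps_smul (by rw [map_sub, sub_eq_zero]; exact congrFun h i)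
  choose v hv using h1
  refine ⟨v, funext fun i => ?_⟩
  rw [Pi.add_apply, Pi.smul_apply, ← hv, add_sub_cancel]

theorem deformP_smul_add {n : ℕ} (u : f.DeformEnv) (z w : DeformP f n) :
    u • (z + w) = u • z + u • w := smul_add u z w

theorem deformP_mul_smul {n : ℕ} (u v : f.DeformEnv) (z : DeformP f n) :
    (u * v) • z = u • v • z := mul_smul u v z

variable (f) (c₁ c₂ c₃ : K)

theorem reduce_deformDiff (n : ℕ) (z : DeformP f (n + 1)) :
    reduce n (deformDiff f c₁ c₂ c₃ n z) = diff K d n (reduce (n + 1) z) := by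
  funext i
  rw [diff_apply, reduce, deformDiff_apply, map_sum]
  simp only [envFst_mul, envFst_deformMat, reduce]

/-- The generator of the deformed resolution in degree zero. -/
noncomputable def deformGen : DeformP f 0 := fun _ => 1

/-- The bimodule map that takes the value `1` at the `i`-th generator and `0` at the others. For
`n = 0` it is the augmentation, and for `n = 4` it lifts the cocycle `e`. -/
noncomputable def deformAug {n : ℕ} (i : Fin (rk n)) : DeformP f n →ₗ[f.DeformEnv] f.Deform :=
  (LinearMap.toSpanSingleton f.DeformEnv f.Deform 1) ∘ₗ LinearMap.proj i

variable {f}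

theorem deformAug_apply {n : ℕ} (i : Fin (rk n)) (z : DeformP f n) :
    deformAug f i z = z i • (1 : f.Deform) := rfl

theorem fst_deformAug {n : ℕ} (i : Fin (rk n)) (z : DeformP f n) :
    (deformAug f i z).1 = reduce n z i • (1 : R20 K d) := fst_env_smul _ _

/-- The entries `a ⊗ 1 + 1 ⊗ a` of the first matrix kill `1`. -/
theorem deformAug_zero_diff [CharP K 2] (i : Fin (rk 0)) (z : DeformP f 1) :
    deformAug f i (deformDiff f c₁ c₂ c₃ 0 z) = 0 := by
  have h (a : f.Deform) (u : f.DeformEnv) :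
      (u * (biTens (DualNumber K) a 1 + biTens (DualNumber K) 1 a)) • (1 : f.Deform) = 0 := by
    have h2 : a + a = 0 := add_self_of_charP_two (DualNumber K) a
    rw [mul_smul, add_smul, biTens_smul_deform, biTens_smul_deform, mul_one, mul_one, one_mul,
      one_mul, h2, smul_zero]
  have hM : ∀ (j : Fin (rk 1)) (i : Fin (rk 0)), ∃ a : f.Deform,
      deformMat f c₁ c₂ c₃ 0 j i = biTens (DualNumber K) a 1 + biTens (DualNumber K) 1 a := by
    change ∀ (j : Fin 2) (i : Fin 1), _
    intro j i
    fin_cases i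
    fin_cases j
    · exact ⟨incl f (x K d), rfl⟩
    · exact ⟨incl f (y K d), rfl⟩
  rw [deformAug_apply, deformDiff_apply, Finset.sum_smul]
  refine Finset.sum_eq_zero fun j _ => ?_
  obtain ⟨a, ha⟩ := hM j i
  rw [ha, h]

/-- The lift of `e` is a cocycle of the deformed complex, because the differential in degree four is
the one in degree zero. -/
theorem deformAug_four_diff [CharP K 2] (i : Fin (rk 4)) (z : DeformP f 5) :
    deformAug f i (deformDiff f c₁ c₂ c₃ 4 z) = 0 :=
  deformAug_zero_diff c₁ c₂ c₃ i z

variable (f)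

/-- The augmentation of the deformed resolution, followed by the section `a ↦ a ⊗ 1`. -/
noncomputable def deformSection : DeformP f 0 →ₗ[DualNumber K] DeformP f 0 :=
  LinearMap.pi fun i => (TensorProduct.mk (DualNumber K) f.Deform _).flip (op 1)
    ∘ₗ (deformAug f i).restrictScalars (DualNumber K)

variable {f}

theorem deformSection_apply (z : DeformP f 0) (i : Fin (rk 0)) :
    deformSection f z = biTens (DualNumber K) (deformAug f i z) 1 • deformGen f := by
  funext j
  obtain rfl : j = i := Subsingleton.elim (α := Fin 1) _ _
  exact (mul_one _).symm

variable [CharP K 2]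

/-- The lift to the deformation of the left-linear endomorphism `wordExt g`. -/
noncomputable def deformWordExt (f : NormalizedCocycle K (R20 K d))
    (g : Fin 8 → Env K (R20 K d)) : f.DeformEnv →ₗ[DualNumber K] f.DeformEnv :=
  leftExt (DualNumber K) (extend (envIncl f ∘ₗ (wordBasis K d).constr K g))

theorem envFst_deformWordExt (g : Fin 8 → Env K (R20 K d)) (z : f.DeformEnv) :
    envFst f (deformWordExt f g z) = wordExt g (envFst f z) := by
  induction z using biTens_induction with
  | zero => simp
  | add u v hu hv => rw [map_add, map_add, map_add, map_add, hu, hv]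
  | biTens a b =>
    rw [deformWordExt, leftExt_biTens, smul_eq_mul, envFst_mul, envFst_biTens, envFst_biTens,
      wordExt, leftExt_biTens, smul_eq_mul]
    congr 1
    simp [extend, envFst_envIncl]

/-- Left-linear maps that lift the contraction `contr` to the deformed resolution. -/
noncomputable def deformContr (f : NormalizedCocycle K (R20 K d)) (n : ℕ) :
    DeformP f n →ₗ[DualNumber K] DeformP f (n + 1) :=
  LinearMap.pi fun l => ∑ j, deformWordExt f (contrCoef K d n j l) ∘ₗ LinearMap.proj j

theorem deformContr_apply (n : ℕ) (z : DeformP f n) (l : Fin (rk (n + 1))) :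
    deformContr f n z l = ∑ j, deformWordExt f (contrCoef K d n j l) (z j) := by
  simp [deformContr]

theorem deformContr_smul (n : ℕ) (a : f.Deform) (z : DeformP f n) :
    deformContr f n (biTens (DualNumber K) a 1 • z)
      = biTens (DualNumber K) a 1 • deformContr f n z := by
  funext l
  simp only [deformContr_apply, Pi.smul_apply, smul_eq_mul, deformWordExt, leftExt_mul,
    Finset.mul_sum]

theorem reduce_deformContr (n : ℕ) (z : DeformP f n) :
    reduce (n + 1) (deformContr f n z) = contr K d n (reduce n z) := by
  funext l
  simp only [contr_apply, reduce, deformContr_apply, map_sum, envFst_deformWordExt]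

/-- The endomorphism `Dt + tD` for `t` the lift `deformContr` of the contraction. It is the identity
modulo `ε`. -/
noncomputable def deformDefect (f : NormalizedCocycle K (R20 K d)) (c₁ c₂ c₃ : K) (n : ℕ) :
    DeformP f n →ₗ[DualNumber K] DeformP f n :=
  contractionDefect (fun n => (deformDiff f c₁ c₂ c₃ n).restrictScalars (DualNumber K))
    (deformContr f) (deformSection f) n

theorem reduce_deformDefect (n : ℕ) (z : DeformP f n) :
    reduce n (deformDefect f c₁ c₂ c₃ n z) = reduce n z := by
  cases n with
  | zero =>
    change reduce 0 (deformDiff f c₁ c₂ c₃ 0 (deformContr f 0 z) + deformSection f z) = _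
    have i : Fin (rk 0) := (0 : Fin 1)
    have hg : reduce 0 (deformGen f) = gen K d := rfl
    rw [reduce_add, reduce_deformDiff, reduce_deformContr, diff_contr_zero,
      deformSection_apply z i, reduce_smul, envFst_biTens, fst_one, fst_deformAug, hg,
      ← aug_apply, add_assoc]
    exact (congrArg _ (add_self_of_charP_two K _)).trans (add_zero _)
  | succ n =>
    change reduce (n + 1) (deformDiff f c₁ c₂ c₃ (n + 1) (deformContr f (n + 1) z)
      + deformContr f n (deformDiff f c₁ c₂ c₃ n z)) = _
    rw [reduce_add, reduce_deformDiff, reduce_deformContr, reduce_deformContr, reduce_deformDiff,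
      diff_contr]

theorem deformDefect_smul (n : ℕ) (a : f.Deform) (z : DeformP f n) :
    deformDefect f c₁ c₂ c₃ n (biTens (DualNumber K) a 1 • z)
      = biTens (DualNumber K) a 1 • deformDefect f c₁ c₂ c₃ n z := by
  cases n with
  | zero =>
    have i : Fin (rk 0) := (0 : Fin 1)
    change deformDiff f c₁ c₂ c₃ 0 (deformContr f 0 _) + deformSection f _
      = _ • (deformDiff f c₁ c₂ c₃ 0 (deformContr f 0 _) + deformSection f _)
    have h : biTens (DualNumber K) (biTens (DualNumber K) a 1 • deformAug f i z) (1 : f.Deform)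
        = biTens (DualNumber K) a 1 * biTens (DualNumber K) (deformAug f i z) 1 := by
      rw [biTens_smul_deform, biTens_mul, mul_one, mul_one]
    rw [deformContr_smul, map_smul, deformSection_apply _ i, deformSection_apply _ i, map_smul, h,
      deformP_mul_smul, deformP_smul_add]
  | succ n =>
    change deformDiff f c₁ c₂ c₃ (n + 1) (deformContr f (n + 1) _)
        + deformContr f n (deformDiff f c₁ c₂ c₃ n _)
      = _ • (deformDiff f c₁ c₂ c₃ (n + 1) (deformContr f (n + 1) _)
        + deformContr f n (deformDiff f c₁ c₂ c₃ n _))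
    rw [deformContr_smul, map_smul, map_smul, deformContr_smul, deformP_smul_add]

end Contraction

end R20

/-! ### The comparison morphism of the deformation -/

namespace R20

open NormalizedCocycle NormalizedCocycle.Deform

variable {K : Type*} [Field K] {d : K}

section DeformedComparison

variable (f : NormalizedCocycle K (R20 K d)) (c₁ c₂ c₃ : K)

theorem deformAug_gen (i : Fin (rk 0)) : deformAug f i (deformGen f) = 1 :=
  one_smul f.DeformEnv (1 : f.Deform)

theorem deformSection_deformSection (z : DeformP f 0) :
    deformSection f (deformSection f z) = deformSection f z := by
  have i : Fin (rk 0) := (0 : Fin 1)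
  rw [deformSection_apply (deformSection f z) i, deformSection_apply z i, map_smul, deformAug_gen f,
    biTens_smul_deform, mul_one, mul_one]

variable [CharP K 2]

/-- The contraction `tc` of the deformed resolution, with `t` a lift of the contraction of `P` and
`c` its defect. -/
noncomputable def correctedContr (n : ℕ) : DeformP f n →ₗ[DualNumber K] DeformP f (n + 1) :=
  deformContr f n ∘ₗ deformDefect f c₁ c₂ c₃ n

/-- The comparison map from the bar resolution of the deformation. -/
noncomputable def deformComparison (n : ℕ) :
    MultilinearMap (DualNumber K) (fun _ : Fin n => f.Deform) (DeformP f n) :=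
  barLift (DualNumber K) (correctedContr f c₁ c₂ c₃) (deformGen f) n

variable {f c₁ c₂ c₃}

theorem reduce_correctedContr (n : ℕ) (z : DeformP f n) :
    reduce (n + 1) (correctedContr f c₁ c₂ c₃ n z) = contr K d n (reduce n z) := by
  rw [correctedContr, LinearMap.comp_apply, reduce_deformContr, reduce_deformDefect]

theorem exists_deformDefect_eq (n : ℕ) (z : DeformP f n) :
    ∃ w, deformDefect f c₁ c₂ c₃ n z = z + (DualNumber.eps : DualNumber K) • w :=
  exists_eq_add_eps_smul (reduce_deformDefect c₁ c₂ c₃ n z)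

theorem deformSection_diff (z : DeformP f 1) :
    deformSection f (deformDiff f c₁ c₂ c₃ 0 z) = 0 := by
  have i : Fin (rk 0) := (0 : Fin 1)
  rw [deformSection_apply _ i, deformAug_zero_diff, biTens_zero_left]
  exact zero_smul f.DeformEnv (deformGen f)

/-- The maps `deformComparison` form a chain map. -/
theorem deformDiff_deformComparison
    (h : HasDeformedRelations f c₁ c₂ c₃) (n : ℕ) (a : Fin (n + 1) → f.Deform) :
    deformDiff f c₁ c₂ c₃ n (deformComparison f c₁ c₂ c₃ (n + 1) a)
      = barD (DualNumber K) (deformComparison f c₁ c₂ c₃ n) a := by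
  have hε : (DualNumber.eps : DualNumber K) * DualNumber.eps = 0 := DualNumber.eps_mul_eps
  have hD := deformDiff_deformDiff h
  refine diff_barLift (DualNumber K) (deformDiff f c₁ c₂ c₃) (correctedContr f c₁ c₂ c₃)
    (deformGen f) (fun n a z => ?_) (fun a => ?_) (fun n z => ?_) n a
  · rw [correctedContr, LinearMap.comp_apply, deformDefect_smul, deformContr_smul]
    rfl
  · have i : Fin (rk 0) := (0 : Fin 1)
    have h1 := diff_corrected_zero
      (D := fun n => (deformDiff f c₁ c₂ c₃ n).restrictScalars (DualNumber K))
      (t := deformContr f) (p := deformSection f) deformSection_diff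
      (deformSection_deformSection f) hε (exists_deformDefect_eq 0)
      (biTens (DualNumber K) 1 a • deformGen f)
    rw [deformSection_apply _ i, map_smul (deformAug f i), deformAug_gen f,
      biTens_smul_deform, one_mul, one_mul] at h1
    have h2 := add_self_of_charP_two (DualNumber K) (biTens (DualNumber K) a 1 • deformGen f)
    refine Eq.trans ?_ (congrArg (· + biTens (DualNumber K) a 1 • deformGen f) h1)
    beta_reduce
    rw [add_assoc, h2, add_zero]
    rfl
  · exact diff_corrected_succ
      (D := fun n => (deformDiff f c₁ c₂ c₃ n).restrictScalars (DualNumber K))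
      (t := deformContr f) (p := deformSection f) hD deformSection_diff hε n
      (exists_deformDefect_eq (n + 1)) z

/-- Modulo `ε` the comparison morphism of the deformation is that of `R(2, 0, d)`. -/
theorem reduce_deformComparison (n : ℕ) (a : Fin n → f.Deform) :
    reduce n (deformComparison f c₁ c₂ c₃ n a) = (stdComparison K d).toFun n fun i => (a i).1 := by
  induction n with
  | zero => rfl
  | succ n ih =>
    change reduce (n + 1) (correctedContr f c₁ c₂ c₃ n
      (biTens (DualNumber K) 1 (a (Fin.last n)) • deformComparison f c₁ c₂ c₃ n (Fin.init a))) = _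
    rw [reduce_correctedContr, reduce_smul, ih, envFst_biTens]
    rfl

end DeformedComparison

end R20

/-! ### The bracket with the cocycle of a deformation -/

section Bracket

variable {K R : Type*} [Field K] [CharP K 2] [Ring R] [Algebra K R]

/-- Merging two entries of a list after applying a map that need not be multiplicative: only the
merged entry differs from the image of the merged list. -/
theorem contractNth_map {A B : Type*} [Mul A] [Mul B] (φ : A → B) {n : ℕ} (j : Fin n)
    (r : Fin (n + 1) → A) :
    Fin.contractNth j.castSucc (· * ·) (fun i => φ (r i))
      = Function.update (fun i => φ (Fin.contractNth j.castSucc (· * ·) r i)) j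
        (φ (r j.castSucc) * φ (r j.succ)) := by
  funext i
  obtain rfl | hij := eq_or_ne i j
  · rw [Function.update_self]
    simp [Fin.contractNth]
  · rw [Function.update_of_ne hij]
    have : (i : ℕ) ≠ j := fun h => hij (Fin.ext h)
    simp only [Fin.contractNth, Fin.val_castSucc, this, if_false]
    split_ifs <;> rfl

/-- The Gerstenhaber bracket with a `2`-cochain in characteristic two. -/
theorem gerstenhaber_two_apply {n : ℕ} (hp : n + 1 + 1 = 2 + n) (F : Cochain K R R 2)
    (g : Cochain K R R n) (r : Fin (n + 1) → R) :
    gerstenhaber hp F g r = F ![g (Fin.init r), r (Fin.last n)] + F ![r 0, g (Fin.tail r)]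
      + ∑ j : Fin n, g (Function.update (Fin.contractNth j.castSucc (· * ·) r) j
          (F ![r j.castSucc, r j.succ])) := by
  have h0 : (-1 : K) = 1 := CharTwo.neg_eq 1
  have h1 : insertAt hp 0 g r = ![g (Fin.init r), r (Fin.last n)] := by
    funext i
    fin_cases i
    · simp [insertAt]
      rfl
    · simp [insertAt]
      rfl
  have h2 : insertAt hp 1 g r = ![r 0, g (Fin.tail r)] := by
    funext i
    fin_cases i
    · simp [insertAt]
    · simp [insertAt]
      congr 1
      funext k
      congr 1
      ext
      simp [add_comm]
  have h3 (j : Fin n) : insertAt (hp.trans (Nat.add_comm 2 n)) j F r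
      = Function.update (Fin.contractNth j.castSucc (· * ·) r) j (F ![r j.castSucc, r j.succ]) := by
    funext i
    simp only [insertAt, Function.update_apply, Fin.contractNth, Fin.ext_iff, Fin.val_castSucc]
    split_ifs
    · omega
    · rfl
    · congr 1
      funext k
      fin_cases k <;> rfl
    · rfl
  rw [gerstenhaber, sub_eq_add_neg, ← neg_one_smul K]
  simp only [h0, one_pow, one_smul, circ, add_apply, sum_apply, circAt,
    substitute_apply, Fin.sum_univ_two, h1, h2, h3]

namespace NormalizedCocycle.Deform

variable {f : NormalizedCocycle K R}

/-- If the cochain `g` extends to a cochain of the deformation along `f` that is a cocycle, then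
the bracket of `f` and `g` is a coboundary: it is the differential of the `ε`-part of the
extension. -/
theorem gerstenhaber_mem_range {n : ℕ} (hp : n + 1 + 1 = 2 + n) {F : Cochain K R R 2}
    (hF : ∀ a b, F ![a, b] = f a b) {g : Cochain K R R n}
    (G : MultilinearMap (DualNumber K) (fun _ : Fin n => f.Deform) f.Deform)
    (hG : ∀ r : Fin (n + 1) → R, barD (DualNumber K) G (fun i => incl f (r i)) = 0)
    (hg : ∀ r : Fin n → R, (G fun i => incl f (r i)).1 = g r) :
    gerstenhaber hp F g ∈ LinearMap.range (hochschildD K R R n) := by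
  let h : Cochain K R R n := (LinearMap.snd K R R : f.Deform →ₗ[K] R).compMultilinearMap
    ((G.restrictScalars K).compLinearMap fun _ => incl f)
  have hh (r : Fin n → R) : (G fun i => incl f (r i)).2 = h r := rfl
  refine ⟨h, MultilinearMap.ext fun r => ?_⟩
  have h1 (j : Fin n) : (G (Fin.contractNth j.castSucc (· * ·) fun i => incl f (r i))).2
      = h (Fin.contractNth j.castSucc (· * ·) r)
        + g (Function.update (Fin.contractNth j.castSucc (· * ·) r) j
          (F ![r j.castSucc, r j.succ])) := by
    have hu (v : R) : Function.update
        (fun i => incl f (Fin.contractNth j.castSucc (· * ·) r i)) j (incl f v)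
        = fun i => incl f (Function.update (Fin.contractNth j.castSucc (· * ·) r) j v i) := by
      funext i
      simp only [Function.update_apply]
      split_ifs <;> rfl
    have hj : Function.update (Fin.contractNth j.castSucc (· * ·) r) j
        (r j.castSucc * r j.succ) = Fin.contractNth j.castSucc (· * ·) r := by
      rw [Function.update_eq_self_iff]
      simp [Fin.contractNth]
    rw [contractNth_map, incl_mul_incl, G.map_update_add, G.map_update_smul, hu, hu, snd_add,
      hj, hh, eps_smul, hg, hF]
  -- The `ε`-part of the cocycle identity for `G`.
  have h2 := congrArg Prod.snd (hG r)
  have h3 : (∑ j : Fin n, G (Fin.contractNth j.castSucc (· * ·) fun i => incl f (r i))).2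
      = ∑ j : Fin n, (G (Fin.contractNth j.castSucc (· * ·) fun i => incl f (r i))).2 :=
    map_sum (LinearMap.snd K R R : f.Deform →ₗ[K] R) _ _
  have ht : Fin.tail (fun i => incl f (r i)) = fun i => incl f (Fin.tail r i) := rfl
  have hi : Fin.init (fun i => incl f (r i)) = fun i => incl f (Fin.init r i) := rfl
  rw [barD, actLast, ht, hi] at h2
  change (_ + _ + _ : f.Deform).2 = 0 at h2
  rw [snd_add, snd_add, h3, biTens_smul_deform, biTens_smul_deform, one_mul, mul_one, snd_mul,
    snd_mul] at h2
  simp only [hh, hg, h1, fst_incl, snd_incl, zero_mul, mul_zero, add_zero, zero_add] at h2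
  rw [hochschildD_eq_barD, barD, actLast, gerstenhaber_two_apply (hp := hp), hF, hF]
  rw [Finset.sum_add_distrib] at h2
  simp only [biTens, env_tmul_smul, one_mul, mul_one]
  have h4 : ∀ r : R, r + r = 0 := add_self_of_charP_two K
  linear_combination (norm := abel) h2 - h4 (f (g (Fin.init r)) (r (Fin.last n)))
    - h4 (f (r 0) (g (Fin.tail r)))
    - h4 (∑ j : Fin n, g (Function.update (Fin.contractNth j.castSucc (· * ·) r) j
          (F ![r j.castSucc, r j.succ])))

end NormalizedCocycle.Deform

end Bracket

/-! ### Explicit formulas in low degrees -/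

section Faces

variable (k : Type*) {A M : Type*} [CommRing k] [Ring A] [Algebra k A] [AddCommGroup M]
  [Module (A ⊗[k] Aᵐᵒᵖ) M]

theorem barD_three_apply (F : (Fin 3 → A) → M) (a b c e : A) :
    barD k F ![a, b, c, e] = biTens k a 1 • F ![b, c, e]
      + (F ![a * b, c, e] + F ![a, b * c, e] + F ![a, b, c * e])
      + biTens k 1 e • F ![a, b, c] := by
  have h0 : Fin.contractNth (0 : Fin 4) (· * ·) ![a, b, c, e] = ![a * b, c, e] := by
    funext i; fin_cases i <;> rfl
  have h1 : Fin.contractNth (1 : Fin 4) (· * ·) ![a, b, c, e] = ![a, b * c, e] := by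
    funext i; fin_cases i <;> rfl
  have h2 : Fin.contractNth (2 : Fin 4) (· * ·) ![a, b, c, e] = ![a, b, c * e] := by
    funext i; fin_cases i <;> rfl
  have h3 : Fin.init ![a, b, c, e] = ![a, b, c] := by funext i; fin_cases i <;> rfl
  simp [barD, actLast, Fin.sum_univ_three, h0, h1, h2, h3]

theorem barD_four_apply (F : (Fin 4 → A) → M) (a b c e u : A) :
    barD k F ![a, b, c, e, u] = biTens k a 1 • F ![b, c, e, u]
      + (F ![a * b, c, e, u] + F ![a, b * c, e, u] + F ![a, b, c * e, u] + F ![a, b, c, e * u])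
      + biTens k 1 u • F ![a, b, c, e] := by
  have h0 : Fin.contractNth (0 : Fin 5) (· * ·) ![a, b, c, e, u] = ![a * b, c, e, u] := by
    funext i; fin_cases i <;> rfl
  have h1 : Fin.contractNth (1 : Fin 5) (· * ·) ![a, b, c, e, u] = ![a, b * c, e, u] := by
    funext i; fin_cases i <;> rfl
  have h2 : Fin.contractNth (2 : Fin 5) (· * ·) ![a, b, c, e, u] = ![a, b, c * e, u] := by
    funext i; fin_cases i <;> rfl
  have h3 : Fin.contractNth (3 : Fin 5) (· * ·) ![a, b, c, e, u] = ![a, b, c, e * u] := by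
    funext i; fin_cases i <;> rfl
  have h4 : Fin.init ![a, b, c, e, u] = ![a, b, c, e] := by funext i; fin_cases i <;> rfl
  simp [barD, actLast, Fin.sum_univ_four, h0, h1, h2, h3, h4]

theorem barD_five_apply (F : (Fin 5 → A) → M) (a b c e u v : A) :
    barD k F ![a, b, c, e, u, v] = biTens k a 1 • F ![b, c, e, u, v]
      + (F ![a * b, c, e, u, v] + F ![a, b * c, e, u, v] + F ![a, b, c * e, u, v]
        + F ![a, b, c, e * u, v] + F ![a, b, c, e, u * v])
      + biTens k 1 v • F ![a, b, c, e, u] := by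
  have h0 : Fin.contractNth (0 : Fin 6) (· * ·) ![a, b, c, e, u, v] = ![a * b, c, e, u, v] := by
    funext i; fin_cases i <;> rfl
  have h1 : Fin.contractNth (1 : Fin 6) (· * ·) ![a, b, c, e, u, v] = ![a, b * c, e, u, v] := by
    funext i; fin_cases i <;> rfl
  have h2 : Fin.contractNth (2 : Fin 6) (· * ·) ![a, b, c, e, u, v] = ![a, b, c * e, u, v] := by
    funext i; fin_cases i <;> rfl
  have h3 : Fin.contractNth (3 : Fin 6) (· * ·) ![a, b, c, e, u, v] = ![a, b, c, e * u, v] := by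
    funext i; fin_cases i <;> rfl
  have h4 : Fin.contractNth (4 : Fin 6) (· * ·) ![a, b, c, e, u, v] = ![a, b, c, e, u * v] := by
    funext i; fin_cases i <;> rfl
  have h5 : Fin.init ![a, b, c, e, u, v] = ![a, b, c, e, u] := by funext i; fin_cases i <;> rfl
  simp [barD, actLast, Fin.sum_univ_five, h0, h1, h2, h3, h4, h5]

theorem barD_barD_four [CharP k 2] [Module k M] (F : (Fin 4 → A) → M) (r : Fin 6 → A) :
    barD k (barD k F) r = 0 := by
  have hr : r = ![r 0, r 1, r 2, r 3, r 4, r 5] := by funext i; fin_cases i <;> rfl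
  rw [hr, barD_five_apply]
  simp only [barD_four_apply, smul_add, biTens_smul, mul_one, one_mul, mul_assoc]
  -- Every term occurs twice.
  have h3 (m : M) : (2 : ℤ) • m = 0 := by rw [two_smul]; exact add_self_of_charP_two k m
  abel_nf
  simp [h3]

end Faces

section Bracket

variable {K R : Type*} [Field K] [CharP K 2] [Ring R] [Algebra K R]

theorem coboundary_mem_cocycles (h : Cochain K R R 4) :
    hochschildD K R R 4 h ∈ cocycles K R 5 := by
  refine LinearMap.mem_ker.2 (MultilinearMap.ext fun r => ?_)
  have h1 : ⇑(hochschildD K R R 4 h) = barD K h := funext fun a => hochschildD_eq_barD h a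
  rw [hochschildD_eq_barD, h1, barD_barD_four]
  rfl

theorem gerstenhaber_two_three_apply (F : Cochain K R R 2) (g : Cochain K R R 3) (a b c e : R) :
    gerstenhaber (n := 2) (m := 3) (p := 4) rfl F g ![a, b, c, e]
      = F ![g ![a, b, c], e] + F ![a, g ![b, c, e]]
      + (g ![F ![a, b], c, e] + g ![a, F ![b, c], e] + g ![a, b, F ![c, e]]) := by
  have h0 (t : R) : Function.update (Fin.contractNth (0 : Fin 4) (· * ·) ![a, b, c, e]) 0 t
      = ![t, c, e] := by
    funext i; fin_cases i <;> rfl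
  have h1 (t : R) : Function.update (Fin.contractNth (1 : Fin 4) (· * ·) ![a, b, c, e]) 1 t
      = ![a, t, e] := by
    funext i; fin_cases i <;> rfl
  have h2 (t : R) : Function.update (Fin.contractNth (2 : Fin 4) (· * ·) ![a, b, c, e]) 2 t
      = ![a, b, t] := by
    funext i; fin_cases i <;> rfl
  have h3 : Fin.init ![a, b, c, e] = ![a, b, c] := by funext i; fin_cases i <;> rfl
  refine (gerstenhaber_two_apply (n := 3) rfl F g _).trans ?_
  rw [Fin.sum_univ_three, h3]
  exact congrArg₂ _ rfl (congrArg₂ _ (congrArg₂ _ (congrArg g (h0 _)) (congrArg g (h1 _)))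
    (congrArg g (h2 _)))

theorem gerstenhaber_two_four_apply (F : Cochain K R R 2) (g : Cochain K R R 4) (a b c e u : R) :
    gerstenhaber (n := 2) (m := 4) (p := 5) rfl F g ![a, b, c, e, u]
      = F ![g ![a, b, c, e], u] + F ![a, g ![b, c, e, u]]
      + (g ![F ![a, b], c, e, u] + g ![a, F ![b, c], e, u] + g ![a, b, F ![c, e], u]
        + g ![a, b, c, F ![e, u]]) := by
  have h0 (t : R) : Function.update (Fin.contractNth (0 : Fin 5) (· * ·) ![a, b, c, e, u]) 0 t
      = ![t, c, e, u] := by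
    funext i; fin_cases i <;> rfl
  have h1 (t : R) : Function.update (Fin.contractNth (1 : Fin 5) (· * ·) ![a, b, c, e, u]) 1 t
      = ![a, t, e, u] := by
    funext i; fin_cases i <;> rfl
  have h2 (t : R) : Function.update (Fin.contractNth (2 : Fin 5) (· * ·) ![a, b, c, e, u]) 2 t
      = ![a, b, t, u] := by
    funext i; fin_cases i <;> rfl
  have h3 (t : R) : Function.update (Fin.contractNth (3 : Fin 5) (· * ·) ![a, b, c, e, u]) 3 t
      = ![a, b, c, t] := by
    funext i; fin_cases i <;> rfl
  have h4 : Fin.init ![a, b, c, e, u] = ![a, b, c, e] := by funext i; fin_cases i <;> rfl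
  refine (gerstenhaber_two_apply (n := 4) rfl F g _).trans ?_
  rw [Fin.sum_univ_four, h4]
  exact congrArg₂ _ rfl (congrArg₂ _ (congrArg₂ _ (congrArg₂ _ (congrArg g (h0 _))
    (congrArg g (h1 _))) (congrArg g (h2 _))) (congrArg g (h3 _)))

theorem gerstenhaber_one_four_apply (u : Cochain K R R 1) (g : Cochain K R R 4) (a b c e : R) :
    gerstenhaber (n := 1) (m := 4) (p := 4) rfl u g ![a, b, c, e] = u ![g ![a, b, c, e]]
      + (g ![u ![a], b, c, e] + g ![a, u ![b], c, e] + g ![a, b, u ![c], e]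
        + g ![a, b, c, u ![e]]) := by
  have h0 : (-1 : K) = 1 := CharTwo.neg_eq 1
  have hu (t : Fin 1 → R) : t = ![t 0] := by funext i; fin_cases i; rfl
  have h1 : insertAt (n := 1) (m := 4) (p := 4) rfl 0 g ![a, b, c, e] = ![g ![a, b, c, e]] := by
    rw [hu (insertAt _ _ _ _)]
    have : (fun k : Fin 4 => ![a, b, c, e] ⟨(0 : Fin 1) + k, by omega⟩) = ![a, b, c, e] := by
      funext k; fin_cases k <;> rfl
    exact congrArg (fun t => ![g t]) this
  have h2 : insertAt (p := 4) (m := 1) (n := 4) rfl 0 u ![a, b, c, e] = ![u ![a], b, c, e] := by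
    funext i
    fin_cases i
    · exact congrArg u (hu _)
    all_goals rfl
  have h3 : insertAt (p := 4) (m := 1) (n := 4) rfl 1 u ![a, b, c, e] = ![a, u ![b], c, e] := by
    funext i
    fin_cases i
    · rfl
    · exact congrArg u (hu _)
    all_goals rfl
  have h4 : insertAt (p := 4) (m := 1) (n := 4) rfl 2 u ![a, b, c, e] = ![a, b, u ![c], e] := by
    funext i
    fin_cases i
    · rfl
    · rfl
    · exact congrArg u (hu _)
    · rfl
  have h5 : insertAt (p := 4) (m := 1) (n := 4) rfl 3 u ![a, b, c, e] = ![a, b, c, u ![e]] := by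
    funext i
    fin_cases i
    · rfl
    · rfl
    · rfl
    · exact congrArg u (hu _)
  rw [gerstenhaber, sub_eq_add_neg, ← neg_one_smul K]
  simp only [h0, one_pow, one_smul, circ, add_apply, circAt,
    substitute_apply, Fin.sum_univ_one, Fin.sum_univ_four, h1, h2, h3, h4, h5]

end Bracket

/-! ### The bracket with a coboundary -/

section Bracket

variable {K R : Type*} [Field K] [Ring R] [Algebra K R]

section Slots

variable (g : Cochain K R R 4) (v : Cochain K R R 3) (F : Cochain K R R 2) (u : Cochain K R R 1)

theorem one_add (p q : R) : u ![p + q] = u ![p] + u ![q] := by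
  have h (t : R) : Function.update ![p] 0 t = ![t] := by funext i; fin_cases i; rfl
  simpa only [h] using u.map_update_add ![p] 0 p q

theorem two_add_fst (p q b : R) : F ![p + q, b] = F ![p, b] + F ![q, b] := by
  simpa only [update_pair_zero] using F.map_update_add ![p, b] 0 p q

theorem two_add_snd (a p q : R) : F ![a, p + q] = F ![a, p] + F ![a, q] := by
  simpa only [update_pair_one] using F.map_update_add ![a, p] 1 p q

theorem three_add_fst (p q b c : R) : v ![p + q, b, c] = v ![p, b, c] + v ![q, b, c] := by
  have h (t : R) : Function.update ![p, b, c] 0 t = ![t, b, c] := by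
    funext i; fin_cases i <;> rfl
  simpa only [h] using v.map_update_add ![p, b, c] 0 p q

theorem three_add_snd (a p q c : R) : v ![a, p + q, c] = v ![a, p, c] + v ![a, q, c] := by
  have h (t : R) : Function.update ![a, p, c] 1 t = ![a, t, c] := by
    funext i; fin_cases i <;> rfl
  simpa only [h] using v.map_update_add ![a, p, c] 1 p q

theorem three_add_trd (a b p q : R) : v ![a, b, p + q] = v ![a, b, p] + v ![a, b, q] := by
  have h (t : R) : Function.update ![a, b, p] 2 t = ![a, b, t] := by
    funext i; fin_cases i <;> rfl
  simpa only [h] using v.map_update_add ![a, b, p] 2 p q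

theorem four_add_fst (p q b c e : R) :
    g ![p + q, b, c, e] = g ![p, b, c, e] + g ![q, b, c, e] := by
  have h (t : R) : Function.update ![p, b, c, e] 0 t = ![t, b, c, e] := by
    funext i; fin_cases i <;> rfl
  simpa only [h] using g.map_update_add ![p, b, c, e] 0 p q

theorem four_add_snd (a p q c e : R) :
    g ![a, p + q, c, e] = g ![a, p, c, e] + g ![a, q, c, e] := by
  have h (t : R) : Function.update ![a, p, c, e] 1 t = ![a, t, c, e] := by
    funext i; fin_cases i <;> rfl
  simpa only [h] using g.map_update_add ![a, p, c, e] 1 p q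

theorem four_add_trd (a b p q e : R) :
    g ![a, b, p + q, e] = g ![a, b, p, e] + g ![a, b, q, e] := by
  have h (t : R) : Function.update ![a, b, p, e] 2 t = ![a, b, t, e] := by
    funext i; fin_cases i <;> rfl
  simpa only [h] using g.map_update_add ![a, b, p, e] 2 p q

theorem four_add_fth (a b c p q : R) :
    g ![a, b, c, p + q] = g ![a, b, c, p] + g ![a, b, c, q] := by
  have h (t : R) : Function.update ![a, b, c, p] 3 t = ![a, b, c, t] := by
    funext i; fin_cases i <;> rfl
  simpa only [h] using g.map_update_add ![a, b, c, p] 3 p q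

end Slots

variable [CharP K 2]

theorem hochschildD_one_apply (u : Cochain K R R 1) (a b : R) :
    hochschildD K R R 1 u ![a, b] = a * u ![b] + u ![a * b] + u ![a] * b := by
  rw [hochschildD_eq_barD, barD_one_apply, biTens, biTens, env_tmul_smul, env_tmul_smul, one_mul,
    mul_one]

theorem hochschildD_two_apply (F : Cochain K R R 2) (a b c : R) :
    hochschildD K R R 2 F ![a, b, c] = a * F ![b, c] + (F ![a * b, c] + F ![a, b * c])
      + F ![a, b] * c := by
  rw [hochschildD_eq_barD, barD_two_apply, biTens, biTens, env_tmul_smul, env_tmul_smul, one_mul,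
    mul_one]

theorem hochschildD_three_apply (v : Cochain K R R 3) (a b c e : R) :
    hochschildD K R R 3 v ![a, b, c, e] = a * v ![b, c, e]
      + (v ![a * b, c, e] + v ![a, b * c, e] + v ![a, b, c * e]) + v ![a, b, c] * e := by
  rw [hochschildD_eq_barD, barD_three_apply, biTens, biTens, env_tmul_smul, env_tmul_smul,
    one_mul, mul_one]

theorem hochschildD_four_apply (g : Cochain K R R 4) (a b c e s : R) :
    hochschildD K R R 4 g ![a, b, c, e, s] = a * g ![b, c, e, s]
      + (g ![a * b, c, e, s] + g ![a, b * c, e, s] + g ![a, b, c * e, s] + g ![a, b, c, e * s])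
      + g ![a, b, c, e] * s := by
  rw [hochschildD_eq_barD, barD_four_apply, biTens, biTens, env_tmul_smul, env_tmul_smul,
    one_mul, mul_one]

/-- The bracket with a `2`-cocycle commutes with the differential. -/
theorem hochschildD_bracket_two_three {F : Cochain K R R 2} (hF : F ∈ cocycles K R 2)
    (v : Cochain K R R 3) :
    hochschildD K R R 4 (gerstenhaber (n := 2) (m := 3) (p := 4) rfl F v)
      = gerstenhaber (n := 2) (m := 4) (p := 5) rfl F (hochschildD K R R 3 v) := by
  refine MultilinearMap.ext fun r => ?_
  have hr : r = ![r 0, r 1, r 2, r 3, r 4] := by funext i; fin_cases i <;> rfl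
  rw [hr]
  generalize r 0 = a, r 1 = b, r 2 = c, r 3 = e, r 4 = s
  have hF' (a b c : R) : a * F ![b, c] + (F ![a * b, c] + F ![a, b * c]) + F ![a, b] * c = 0 := by
    rw [← hochschildD_two_apply]
    exact MultilinearMap.congr_fun (LinearMap.mem_ker.1 hF) _
  -- The two sides differ by cocycle identities of `F`, with `v` inside `F` or `F` inside `v`.
  have h1 := hF' a b (v ![c, e, s])
  have h2 := hF' a (v ![b, c, e]) s
  have h3 := hF' (v ![a, b, c]) e s
  have h4 := congrArg (fun t => v ![t, e, s]) (hF' a b c)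
  have h5 := congrArg (fun t => v ![a, t, s]) (hF' b c e)
  have h6 := congrArg (fun t => v ![a, b, t]) (hF' c e s)
  have z4 : v ![0, e, s] = 0 := v.map_coord_zero 0 rfl
  have z5 : v ![a, 0, s] = 0 := v.map_coord_zero 1 rfl
  have z6 : v ![a, b, 0] = 0 := v.map_coord_zero 2 rfl
  simp only [three_add_fst, three_add_snd, three_add_trd, z4, z5, z6] at h4 h5 h6
  refine Eq.trans ?_ (gerstenhaber_two_four_apply _ _ a b c e s).symm
  simp only [hochschildD_four_apply, gerstenhaber_two_three_apply,
    hochschildD_three_apply, two_add_fst, two_add_snd, mul_add, add_mul]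
  have hs (m : R) : (2 : ℤ) • m = 0 := by rw [two_smul]; exact add_self_of_charP_two K m
  have hn (m : R) : -m = m := neg_eq_of_add_eq_zero_left (add_self_of_charP_two K m)
  rw [← sub_eq_zero]
  linear_combination (norm := skip) h1 + h2 + h3 + h4 + h5 + h6
  simp only [sub_eq_add_neg, hn]
  abel_nf
  simp [hs]

/-- The bracket of a coboundary with a `4`-cocycle is a coboundary. -/
theorem hochschildD_bracket_one_four (u : Cochain K R R 1) {g : Cochain K R R 4}
    (hg : g ∈ cocycles K R 4) :
    hochschildD K R R 4 (gerstenhaber (n := 1) (m := 4) (p := 4) rfl u g)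
      = gerstenhaber (n := 2) (m := 4) (p := 5) rfl (hochschildD K R R 1 u) g := by
  refine MultilinearMap.ext fun r => ?_
  have hr : r = ![r 0, r 1, r 2, r 3, r 4] := by funext i; fin_cases i <;> rfl
  rw [hr]
  generalize r 0 = a, r 1 = b, r 2 = c, r 3 = e, r 4 = s
  have hg' (a b c e s : R) : a * g ![b, c, e, s]
      + (g ![a * b, c, e, s] + g ![a, b * c, e, s] + g ![a, b, c * e, s] + g ![a, b, c, e * s])
      + g ![a, b, c, e] * s = 0 := by
    rw [← hochschildD_four_apply]
    exact MultilinearMap.congr_fun (LinearMap.mem_ker.1 hg) _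
  -- The two sides differ by cocycle identities of `g`, with `u` inside `g` or `g` inside `u`.
  have h1 := hg' (u ![a]) b c e s
  have h2 := hg' a (u ![b]) c e s
  have h3 := hg' a b (u ![c]) e s
  have h4 := hg' a b c (u ![e]) s
  have h5 := hg' a b c e (u ![s])
  have h6 := congrArg (fun t => u ![t]) (hg' a b c e s)
  have z6 : u ![0] = 0 := u.map_coord_zero 0 rfl
  simp only [one_add, z6] at h6
  refine Eq.trans ?_ (gerstenhaber_two_four_apply _ _ a b c e s).symm
  simp only [hochschildD_four_apply, gerstenhaber_one_four_apply,
    hochschildD_one_apply, four_add_fst, four_add_snd, four_add_trd, four_add_fth, mul_add,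
    add_mul]
  have hs (m : R) : (2 : ℤ) • m = 0 := by rw [two_smul]; exact add_self_of_charP_two K m
  have hn (m : R) : -m = m := neg_eq_of_add_eq_zero_left (add_self_of_charP_two K m)
  rw [← sub_eq_zero]
  linear_combination (norm := skip) h1 + h2 + h3 + h4 + h5 + h6
  simp only [sub_eq_add_neg, hn]
  abel_nf
  simp [hs]

end Bracket

/-! ### Vanishing of the brackets -/

section Bracket

variable {K R : Type*} [Field K] [CharP K 2] [Ring R] [Algebra K R]

theorem bracket_add_left (F F' : Cochain K R R 2) (g : Cochain K R R 4) :
    gerstenhaber (n := 2) (m := 4) (p := 5) rfl (F + F') g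
      = gerstenhaber (n := 2) (m := 4) (p := 5) rfl F g
        + gerstenhaber (n := 2) (m := 4) (p := 5) rfl F' g := by
  refine MultilinearMap.ext fun r => ?_
  have hr : r = ![r 0, r 1, r 2, r 3, r 4] := by funext i; fin_cases i <;> rfl
  rw [hr]
  simp only [add_apply, gerstenhaber_two_four_apply, four_add_fst, four_add_snd,
    four_add_trd, four_add_fth]
  abel

theorem bracket_add_right (F : Cochain K R R 2) (g g' : Cochain K R R 4) :
    gerstenhaber (n := 2) (m := 4) (p := 5) rfl F (g + g')
      = gerstenhaber (n := 2) (m := 4) (p := 5) rfl F g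
        + gerstenhaber (n := 2) (m := 4) (p := 5) rfl F g' := by
  refine MultilinearMap.ext fun r => ?_
  have hr : r = ![r 0, r 1, r 2, r 3, r 4] := by funext i; fin_cases i <;> rfl
  rw [hr]
  simp only [add_apply, gerstenhaber_two_four_apply, two_add_fst, two_add_snd]
  abel

/-- The vanishing of the bracket in cohomology does not depend on the representing cocycles. -/
theorem isGerstenhaberBracket_zero_of_mem_range (F₀ : cocycles K R 2) (g₀ : cocycles K R 4)
    (h : gerstenhaber (n := 2) (m := 4) (p := 5) rfl (F₀ : Cochain K R R 2) (g₀ : Cochain K R R 4)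
      ∈ LinearMap.range (hochschildD K R R 4)) :
    IsGerstenhaberBracket (n := 2) (m := 4) (p := 5) rfl (HH.mk F₀) (HH.mk g₀) 0 := by
  intro F g hF hg
  obtain ⟨u, hu⟩ : ∃ u : Cochain K R R 1, hochschildD K R R 1 u = F - F₀ :=
    Submodule.mem_comap.1 ((Submodule.Quotient.eq _).1 hF)
  obtain ⟨v, hv⟩ : ∃ v : Cochain K R R 3, hochschildD K R R 3 v = g - g₀ :=
    Submodule.mem_comap.1 ((Submodule.Quotient.eq _).1 hg)
  obtain ⟨w, hw⟩ := h
  have hF' : (F : Cochain K R R 2) = F₀ + hochschildD K R R 1 u := by rw [hu, add_sub_cancel]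
  have hg' : (g : Cochain K R R 4) = g₀ + hochschildD K R R 3 v := by rw [hv, add_sub_cancel]
  have hmem : gerstenhaber (n := 2) (m := 4) (p := 5) rfl (F : Cochain K R R 2)
      (g : Cochain K R R 4) ∈ LinearMap.range (hochschildD K R R 4) := by
    rw [hg', bracket_add_right, hF', bracket_add_left, ← hF']
    refine add_mem (add_mem ⟨w, hw⟩ ⟨_, hochschildD_bracket_one_four u g₀.2⟩)
      ⟨_, hochschildD_bracket_two_three F.2 v⟩
  obtain ⟨s, hs⟩ := hmem
  have hc : gerstenhaber (n := 2) (m := 4) (p := 5) rfl (F : Cochain K R R 2)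
      (g : Cochain K R R 4) ∈ cocycles K R 5 := hs ▸ coboundary_mem_cocycles s
  exact ⟨hc, (Submodule.Quotient.mk_eq_zero _).2 (Submodule.mem_comap.2 ⟨s, hs⟩)⟩

end Bracket

namespace R20

open NormalizedCocycle NormalizedCocycle.Deform

variable {K : Type*} [Field K] [CharP K 2] {d : K}

/-- The bracket of the cocycles of `c₁w₁ + c₂w₂ + c₃w₃` and `e` is a coboundary, because the
cocycle of `e` extends to the deformation. -/
theorem gerstenhaber_wComb_e (c₁ c₂ c₃ : K) :
    gerstenhaber (n := 2) (m := 4) (p := 5) rfl ((stdComparison K d).pull (wComb d c₁ c₂ c₃).1)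
      ((stdComparison K d).pull (e K d).1) ∈
        LinearMap.range (hochschildD K (R20 K d) (R20 K d) 4) := by
  have h : HasDeformedRelations (wCocycle d c₁ c₂ c₃) c₁ c₂ c₃ :=
    deformedRelations_wCocycle c₁ c₂ c₃
  generalize hf : wCocycle d c₁ c₂ c₃ = f at h
  have hf' : ∀ a b, (stdComparison K d).pull (wComb d c₁ c₂ c₃).1 ![a, b] = f a b := fun a b => by
    rw [← hf]; rfl
  let i : Fin (rk 4) := (0 : Fin 1)
  refine gerstenhaber_mem_range (n := 4) rfl hf'
    (((deformAug f i).restrictScalars (DualNumber K)).compMultilinearMap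
      (deformComparison f c₁ c₂ c₃ 4)) (fun r => ?_) fun r => ?_
  · have h1 := deformAug_four_diff c₁ c₂ c₃ i
      (deformComparison f c₁ c₂ c₃ 5 fun i => incl f (r i))
    rw [deformDiff_deformComparison h] at h1
    rw [← h1]
    simp only [barD, actLast, map_add, map_sum, map_smul]
    rfl
  · change (deformAug f i _).1 = _
    rw [fst_deformAug, reduce_deformComparison]
    change _ = (e K d).1 _
    exact (Fin.sum_univ_one fun i : Fin 1 =>
      (stdComparison K d).toFun 4 r i • (1 : R20 K d)).symm

theorem exists_eq_wComb {v : CocycleP K d 2}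
    (hv : v ∈ ({w₁ K d, w₂ K d, w₃ K d} : Set (CocycleP K d 2))) :
    ∃ c₁ c₂ c₃, v = wComb d c₁ c₂ c₃ := by
  have h (v : CocycleP K d 2) (c₁ c₂ c₃ : K)
      (h : v.1 = c₁ • (w₁ K d).1 + c₂ • (w₂ K d).1 + c₃ • (w₃ K d).1) :
      ∃ c₁ c₂ c₃, v = wComb d c₁ c₂ c₃ :=
    ⟨c₁, c₂, c₃, Subtype.ext (h.trans (ofValues_wVal c₁ c₂ c₃).symm)⟩
  obtain hv | hv | hv := hv
  · exact h v 1 0 0 (by rw [hv, one_smul, zero_smul, zero_smul, add_zero, add_zero])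
  · exact h v 0 1 0 (by rw [hv, one_smul, zero_smul, zero_smul, add_zero, zero_add])
  · exact h v 0 0 1 (by
      rw [Set.mem_singleton_iff.1 hv, one_smul, zero_smul, zero_smul, add_zero, zero_add])

end R20

theorem mainTheorem4 (K : Type*) [Field K] [IsAlgClosed K] [CharP K 2] (d : K) :
    Nonempty (R20.Comparison K d) ∧
      ∀ Ψ : R20.Comparison K d, ∀ v ∈ ({R20.w₁ K d, R20.w₂ K d, R20.w₃ K d} : Set _),
        IsGerstenhaberBracket (n := 2) (m := 4) (p := 5) rfl (Ψ.toHH v) (Ψ.toHH (R20.e K d)) 0 := by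
  refine ⟨⟨R20.stdComparison K d⟩, fun Ψ v hv => ?_⟩
  obtain ⟨c₁, c₂, c₃, rfl⟩ := R20.exists_eq_wComb hv
  have hw : Ψ.toHH (R20.wComb d c₁ c₂ c₃)
      = HH.mk ⟨_, (R20.stdComparison K d).pull_mem (R20.wComb d c₁ c₂ c₃)⟩ :=
    R20.Comparison.toHH_eq Ψ (n := 1) _
  have he : Ψ.toHH (R20.e K d) = HH.mk ⟨_, (R20.stdComparison K d).pull_mem (R20.e K d)⟩ :=
    R20.Comparison.toHH_eq Ψ (n := 3) _
  rw [hw, he]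
  have h := isGerstenhaberBracket_zero_of_mem_range
    ⟨_, (R20.stdComparison K d).pull_mem (R20.wComb d c₁ c₂ c₃)⟩
    ⟨_, (R20.stdComparison K d).pull_mem (R20.e K d)⟩ (R20.gerstenhaber_wComb_e c₁ c₂ c₃)
  exact h
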